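/- Let $\Bbbk$ be a field. For integers $n\ge 6$ and $r\ge 1$, let $\mathrm{H}_n$ be the graph on the vertices $x_1,\dots,x_n$ with edges $$\{x_ix_{i+1}: 1\le i\le n-5\}\cup\{x_{n-4}x_{n-2},\,x_{n-2}x_{n-3}\}\cup\{x_{n-1}x_j: j\in[n]\setminus\{1,n-1\}\}\cup\{x_nx_j: j\in[n]\setminus\{n-3,n\}\},$$ where $[n]=\{1,\dots,n\}$, and let $\mathrm{LH}_{n,r}$ be the graph on the vertices $x_1,\dots,x_{n+r}$ whose edges are those of $\mathrm{H}_n$, all $x_{n+i}x_j$ with $1\le i\le r$ and $j\in[n]\setminus\{n-3\}$, and all $x_{n+i}x_{n+j}$ with $1\le i<j\le r$. Thus the complement graph $\mathrm{LH}_{n,r}^c$ is $\mathrm{H}_n^c$ with $r$ extra leaves attached to $x_{n-3}$. For a finite simple graph $G$ with vertex set $\{x_1,\dots,x_N\}$, let $I(G)\subseteq S=\Bbbk[x_1,\dots,x_N]$ be its edge ideal, generated by the monomials $x_ux_v$ with $x_ux_v$ an edge of $G$. For $k\ge 0$, let $\mathrm{HS}_k(G)$ be the $k$-th homological shift ideal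 of $I(G)$: if $F_k=\bigoplus_j S(-\mathbf a_{kj})$ is the $k$-th module of the $\mathbb N^N$-graded minimal free resolution $\cdots\to F_1\to F_0\to I(G)\to 0$, then $\mathrm{HS}_k(G)$ is the ideal generated by the monomials $\mathbf x^{\mathbf a_{kj}}$. A monomial ideal has linear quotients if its minimal monomial generators can be ordered as $m_1,\dots,m_q$ such that the ideal $(m_1,\dots,m_i):m_{i+1}$ is generated by variables for every $1\le i\le q-1$. Then, for all integers $n\ge 6$ and $r\ge 1$: 1. if $2\le k\le n-4$, then $\mathrm{HS}_k(\mathrm{LH}_{n,r}^c)$ is nonzero and does not have linear quotients; 2. if $n-4<k\le n+r-4$, then $\mathrm{HS}_k(\mathrm{LH}_{n,r}^c)$ is nonzero and has linear quotients; 3. if $k>n+r-4$, then $\mathrm{HS}_k(\mathrm{LH}_{n,r}^c)=0$. -/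

import Mathlib

namespace HLQ

open MvPolynomial

noncomputable section

/-! ### Multigraded minimal free resolutions and homological shift ideals -/

/-- In the free module `⨁ₗ S(-shift l)` over `S = 𝕜[x_v : v ∈ σ]`, a vector `v` is homogeneous of
multidegree `a` if each term of its `l`-th coordinate is a scalar multiple of a monomial `x ^ m`
with `m + shift l = a`. -/
def IsMultihomogeneous {σ 𝕜 ι : Type*} [Field 𝕜] (shift : ι → (σ →₀ ℕ))
    (a : σ →₀ ℕ) (v : ι →₀ MvPolynomial σ 𝕜) : Prop :=
  ∀ l, ∀ m ∈ (v l).support, m + shift l = a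

/-- A multigraded minimal free resolution
`⋯ → F₂ → F₁ → F₀ → I → 0`, where `F i = ⨁ⱼ S(-shift i j)` and `j` runs over the finite
set `ι i`, of an ideal `I` of `S = 𝕜[x_v : v ∈ σ]`. -/
structure MinimalFreeResolution {σ 𝕜 : Type*} [Field 𝕜] (I : Ideal (MvPolynomial σ 𝕜)) where
  /-- the index set of the basis of `F i` -/
  ι : ℕ → Type
  finite : ∀ i, Finite (ι i)
  /-- the multidegree of the `j`-th basis element of `F i` -/
  shift : (i : ℕ) → ι i → (σ →₀ ℕ)
  /-- the augmentation `F 0 → I` (as a map to `S`) -/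
  aug : (ι 0 →₀ MvPolynomial σ 𝕜) →ₗ[MvPolynomial σ 𝕜] MvPolynomial σ 𝕜
  /-- the differential `F (i + 1) → F i` -/
  d : (i : ℕ) → (ι (i + 1) →₀ MvPolynomial σ 𝕜) →ₗ[MvPolynomial σ 𝕜]
    (ι i →₀ MvPolynomial σ 𝕜)
  /-- the augmentation preserves multidegrees -/
  aug_homogeneous : ∀ j, ∀ m ∈ (aug (Finsupp.single j 1)).support, m = shift 0 j
  /-- the differentials preserve multidegrees -/
  d_homogeneous : ∀ i j,
    IsMultihomogeneous (shift i) (shift (i + 1) j) (d i (Finsupp.single j 1))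
  range_aug : LinearMap.range aug = I
  exact_aug : LinearMap.range (d 0) = LinearMap.ker aug
  exact : ∀ i, LinearMap.range (d (i + 1)) = LinearMap.ker (d i)
  /-- minimality: the image of each differential lies in `(x_v : v ∈ σ) F i` -/
  minimal : ∀ i, LinearMap.range (d i) ≤
    Ideal.span (Set.range (X : σ → MvPolynomial σ 𝕜)) •
      (⊤ : Submodule (MvPolynomial σ 𝕜) (ι i →₀ MvPolynomial σ 𝕜))

/-- The `k`-th homological shift ideal `HS_k(I)`, generated by the monomials `x ^ a` for the
multidegrees `a` of the basis elements in homological degree `k` of the multigraded minimal free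
resolution of `I`. That resolution is unique up to isomorphism, so letting `F` run over all
of them gives the same ideal as fixing one. -/
def HS {σ 𝕜 : Type*} [Field 𝕜] (k : ℕ) (I : Ideal (MvPolynomial σ 𝕜)) :
    Ideal (MvPolynomial σ 𝕜) :=
  Ideal.span {f | ∃ (F : MinimalFreeResolution I) (j : F.ι k), f = monomial (F.shift k j) 1}

/-! ### Linear quotients -/

/-- The exponents of the minimal monomial generators of a monomial ideal `I`: those `a` for which
`x ^ a` is minimal under divisibility among the monomials in `I`. -/
def minGens {σ 𝕜 : Type*} [Field 𝕜] (I : Ideal (MvPolynomial σ 𝕜)) : Set (σ →₀ ℕ) :=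
  {a | Minimal (fun b => (monomial b (1 : 𝕜)) ∈ I) a}

/-- A monomial ideal `I` has linear quotients if its minimal monomial generators can be ordered
as `m 0, …, m (q - 1)` so that each ideal `(m 0, …, m (i - 1)) : m i` with `0 < i < q` is
generated by variables. -/
def HasLinearQuotients {σ 𝕜 : Type*} [Field 𝕜] (I : Ideal (MvPolynomial σ 𝕜)) : Prop :=
  ∃ (q : ℕ) (m : Fin q → (σ →₀ ℕ)), Function.Injective m ∧ Set.range m = minGens I ∧
    ∀ i : Fin q, 0 < i.val → ∃ A : Set σ,
      (Ideal.span ((fun t => monomial (m t) (1 : 𝕜)) '' Set.Iio i)).colon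
          {monomial (m i) (1 : 𝕜)} =
        Ideal.span ((X : σ → MvPolynomial σ 𝕜) '' A)

/-! ### Graphs -/

/-- The edge ideal of a graph, generated by the `x_u x_v` with `u v` an edge. -/
def edgeIdeal (𝕜 : Type*) [Field 𝕜] {V : Type*} (G : SimpleGraph V) : Ideal (MvPolynomial V 𝕜) :=
  Ideal.span {f | ∃ u v, G.Adj u v ∧ f = X u * X v}

/-- The list of edges of `H_n` (`n ≥ 6`), each given as an ordered pair of labels in
`{1, …, n}` in one of its two orders or in both. -/
def edgeH (n i j : ℕ) : Prop :=
  (i ∈ Finset.Icc 1 (n - 5) ∧ j = i + 1) ∨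
  (i = n - 4 ∧ j = n - 2) ∨
  (i = n - 2 ∧ j = n - 3) ∨
  (i = n - 1 ∧ j ∈ Finset.Icc 1 n \ {1, n - 1}) ∨
  (i = n ∧ j ∈ Finset.Icc 1 n \ {n - 3, n})

/-- The list of edges of `LH_{n,r}`, as pairs of labels in `{1, …, n + r}`. -/
def edgeLH (n r i j : ℕ) : Prop :=
  edgeH n i j ∨
  (i ∈ Finset.Icc (n + 1) (n + r) ∧ j ∈ Finset.Icc 1 n \ {n - 3}) ∨
  (i ∈ Finset.Icc (n + 1) (n + r) ∧ j ∈ Finset.Icc (n + 1) (n + r))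

/-- The graph `LH_{n,r}` on the vertices `x_1, …, x_{n+r}`; the vertex `x_i` is the element
`i - 1` of `Fin (n + r)`. -/
def LH (n r : ℕ) : SimpleGraph (Fin (n + r)) :=
  SimpleGraph.fromRel fun u v => edgeLH n r (u.val + 1) (v.val + 1)

end

end HLQ

/-! The vertices `x_1, …, x_{n-4}, x_{n-2}, x_{n-3}` of `LH` form a path. Renumber them `1, …, m`
with `m = n - 2`, and the others `m + 1, …, N` with `N = n + r`. In the complement `G` of `LH` the
vertex `m + 1` is then a leaf at `1`, the vertices `m + 2, …, N` are leaves at `m`, and two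
vertices of the path are adjacent when they are not consecutive.

*Resolution.* Ordering the edges of `G` lexicographically by their larger and their smaller end,
the edge ideal has linear quotients (`IsRanked.lexLinear`). The iterated mapping cone of the
Koszul complexes on the variables of the successive colon ideals is therefore a minimal free
resolution, and it has a basis element of multidegree `x_i x_j ∏_{b ∈ B} x_b` for each edge `i j`
and each subset `B` of the variables of its colon ideal (`hasRes_of_linearQuotients`). A second
resolution is compared with it by chain maps in both directions, which compose to a map homotopic
to the identity (`BasedComplex.exists_shift_eq`), so these multidegrees generate the homological
shift ideals (`HS_edgeIdeal`). All of this is done with scalar matrices: setting the variables of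
a multigraded complex to `1` loses nothing as long as the multidegrees of the basis elements are
remembered, and exactness in multidegree `a` becomes exactness of the subcomplex spanned by the
basis elements of multidegree at most `a` (`BasedComplex`).

*Linear quotients.* The generators of `HS_k` have as supports some sets `W` with `k + 2` elements,
of three shapes (`IsRanked.cases_of_mem_shiftSets`): subsets of the path; sets containing `1` and
the leaf `m + 1`, but not `2`; and sets containing `m` and some of the leaves at `m`, but not
`m - 1`. If `k > n - 4`, only the last shape has enough elements, and `HS_k` is `x_m` times a
squarefree Veronese ideal, which has linear quotients (`IsRanked.hasLinearQuotients_of_high`). If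
`2 ≤ k ≤ n - 4`, there is a generator of the second and one of the third shape that differ in two
variables, while no other generator divides their least common multiple
(`IsRanked.not_hasLinearQuotients_of_low`). -/

namespace HLQ

/-! ### Multigraded complexes over the field -/

noncomputable section

open Finsupp

/-- A multigraded complex of free `S`-modules, dehomogenized: `j : ι` is a basis element of
homological degree `hdeg j` and multidegree `shift j`, and `d` is the differential with all
variables set to `1`. The basis element `base` is the only one in homological degree `0`. -/
structure BasedComplex (σ 𝕜 : Type*) [Field 𝕜] where
  /-- the basis, in all homological degrees together -/
  ι : Type
  /-- the homological degree of a basis element -/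
  hdeg : ι → ℕ
  /-- the multidegree of a basis element -/
  shift : ι → (σ →₀ ℕ)
  /-- the differential -/
  d : (ι →₀ 𝕜) →ₗ[𝕜] (ι →₀ 𝕜)
  d_d : ∀ x, d (d x) = 0
  d_single : ∀ j l, d (single j 1) l ≠ 0 → hdeg l + 1 = hdeg j ∧ shift l ≤ shift j
  /-- the basis element of homological degree `0` -/
  base : ι
  hdeg_eq_zero : ∀ j, hdeg j = 0 ↔ j = base

theorem map_mem_of_single {α 𝕜 M : Type*} [Field 𝕜] [AddCommGroup M] [Module 𝕜 M]
    (f : (α →₀ 𝕜) →ₗ[𝕜] M) (N : Submodule 𝕜 M) (x : α →₀ 𝕜)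
    (h : ∀ j, x j ≠ 0 → f (single j 1) ∈ N) : f x ∈ N := by
  rw [← Finsupp.sum_single x, Finsupp.sum, map_sum]
  refine N.sum_mem fun j hj => ?_
  have : single j (x j) = x j • single j (1 : 𝕜) := by simp
  rw [this, map_smul]
  exact N.smul_mem _ (h j (by simpa using hj))

theorem map_eq_of_single {α 𝕜 M : Type*} [Field 𝕜] [AddCommGroup M] [Module 𝕜 M]
    (f g : (α →₀ 𝕜) →ₗ[𝕜] M) (x : α →₀ 𝕜)
    (h : ∀ j, x j ≠ 0 → f (single j 1) = g (single j 1)) : f x = g x := by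
  have := map_mem_of_single (f - g) ⊥ x (fun j hj => by simp [h j hj])
  simpa [sub_eq_zero] using this

theorem exists_apply_single_ne_zero {α β 𝕜 : Type*} [Field 𝕜] (f : (α →₀ 𝕜) →ₗ[𝕜] (β →₀ 𝕜))
    {x : α →₀ 𝕜} {i : β} (h : f x i ≠ 0) : ∃ l, x l ≠ 0 ∧ f (single l 1) i ≠ 0 := by
  by_contra! H
  refine h ?_
  have := map_mem_of_single f (LinearMap.ker (Finsupp.lapply i : (β →₀ 𝕜) →ₗ[𝕜] 𝕜)) x
    (fun j hj => by simpa using H j hj)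
  simpa using this

namespace BasedComplex

variable {σ 𝕜 : Type*} [Field 𝕜]

/-- The strand in homological degree `k` and multidegree `a`: after dehomogenization it consists
of the vectors supported on the basis elements of multidegree at most `a`. -/
def part (C : BasedComplex σ 𝕜) (k : ℕ) (a : σ →₀ ℕ) : Submodule 𝕜 (C.ι →₀ 𝕜) :=
  Finsupp.supported 𝕜 𝕜 {j | C.hdeg j = k ∧ C.shift j ≤ a}

theorem mem_part {C : BasedComplex σ 𝕜} {k : ℕ} {a : σ →₀ ℕ} {x : C.ι →₀ 𝕜} :
    x ∈ C.part k a ↔ ∀ j, x j ≠ 0 → C.hdeg j = k ∧ C.shift j ≤ a := by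
  simp [part, Finsupp.mem_supported, Set.subset_def]

theorem single_mem_part (C : BasedComplex σ 𝕜) (j : C.ι) (c : 𝕜) {a : σ →₀ ℕ} (h : C.shift j ≤ a) :
    single j c ∈ C.part (C.hdeg j) a := by
  classical
  rw [mem_part]
  intro l hl
  rw [Finsupp.single_apply] at hl
  by_cases e : j = l
  · subst e; exact ⟨rfl, h⟩
  · simp [e] at hl

theorem part_mono (C : BasedComplex σ 𝕜) (k : ℕ) {a b : σ →₀ ℕ} (h : a ≤ b) :
    C.part k a ≤ C.part k b := fun x hx => by
  rw [mem_part] at hx ⊢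
  exact fun j hj => ⟨(hx j hj).1, (hx j hj).2.trans h⟩

@[simp] theorem hdeg_base (C : BasedComplex σ 𝕜) : C.hdeg C.base = 0 := (C.hdeg_eq_zero _).2 rfl

theorem d_eq_zero_of_hdeg (C : BasedComplex σ 𝕜) {j : C.ι} (h : C.hdeg j = 0) :
    C.d (single j 1) = 0 := by
  ext l
  by_contra hl
  have := (C.d_single j l hl).1
  omega

@[simp] theorem d_base (C : BasedComplex σ 𝕜) (c : 𝕜) : C.d (single C.base c) = 0 := by
  have : single C.base c = c • single C.base (1 : 𝕜) := by simp
  rw [this, map_smul, C.d_eq_zero_of_hdeg C.hdeg_base, smul_zero]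

theorem d_single_mem_part (C : BasedComplex σ 𝕜) {j : C.ι} {k : ℕ} (h : C.hdeg j = k + 1) :
    C.d (single j 1) ∈ C.part k (C.shift j) := by
  rw [mem_part]
  intro l hl
  have := C.d_single j l hl
  exact ⟨by omega, this.2⟩

theorem d_mem_part (C : BasedComplex σ 𝕜) {k : ℕ} {a : σ →₀ ℕ} {x : C.ι →₀ 𝕜}
    (hx : x ∈ C.part (k + 1) a) : C.d x ∈ C.part k a := by
  rw [mem_part] at hx
  exact map_mem_of_single _ _ _ fun j hj =>
    C.part_mono _ (hx j hj).2 (C.d_single_mem_part (hx j hj).1)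

theorem d_eq_zero_of_mem_part (C : BasedComplex σ 𝕜) {a : σ →₀ ℕ} {x : C.ι →₀ 𝕜}
    (hx : x ∈ C.part 0 a) : C.d x = 0 := by
  rw [mem_part] at hx
  simpa using map_mem_of_single C.d ⊥ x fun j hj => by
    simpa using C.d_eq_zero_of_hdeg (hx j hj).1

/-- `C` is acyclic in each multidegree of `U`. -/
def Acyclic (C : BasedComplex σ 𝕜) (U : Set (σ →₀ ℕ)) : Prop :=
  ∀ a ∈ U, ∀ k, ∀ z ∈ C.part k a, C.d z = 0 → ∃ w ∈ C.part (k + 1) a, C.d w = z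

/-- `C` is minimal: no entry of its differential is a nonzero constant. -/
def Minimal (C : BasedComplex σ 𝕜) : Prop :=
  ∀ j l, C.d (single j 1) l ≠ 0 → C.shift l ≠ C.shift j

/-- A preimage of the cycle `z` under the differential, if there is one, chosen to be `0` for
`z = 0`. -/
def preimage (C : BasedComplex σ 𝕜) (k : ℕ) (a : σ →₀ ℕ) (z : C.ι →₀ 𝕜) : C.ι →₀ 𝕜 :=
  open Classical in
  if z = 0 then 0 else if h : ∃ w ∈ C.part k a, C.d w = z then h.choose else 0

theorem preimage_spec (C : BasedComplex σ 𝕜) {k : ℕ} {a : σ →₀ ℕ} {z : C.ι →₀ 𝕜}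
    (h : z = 0 ∨ ∃ w ∈ C.part k a, C.d w = z) :
    C.preimage k a z ∈ C.part k a ∧ C.d (C.preimage k a z) = z := by
  unfold preimage
  by_cases hz : z = 0
  · simp [hz]
  · have h' := h.resolve_left hz
    simp only [hz, if_false, dif_pos h']
    exact h'.choose_spec

/-- The values on basis elements of the map of `exists_lift`, by recursion on the homological
degree. -/
def liftFun (C E : BasedComplex σ 𝕜) (s : ℕ) (ε : 𝕜) (c : (C.ι →₀ 𝕜) →ₗ[𝕜] (E.ι →₀ 𝕜)) (j : C.ι) :
    E.ι →₀ 𝕜 :=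
  E.preimage (C.hdeg j + s) (C.shift j) (c (single j 1) +
    ε • ∑ l ∈ (C.d (single j 1)).support.attach, C.d (single j 1) l.1 • liftFun C E s ε c l.1)
termination_by C.hdeg j
decreasing_by
  have := (C.d_single j l.1 (Finsupp.mem_support_iff.1 l.2)).1
  omega

/-- The lifting property of acyclic complexes: `d T = c + ε T d` has a homogeneous solution `T`
of homological degree `s` as soon as the right-hand side is a cycle, that is `d c + ε c d = 0`.
Chain maps (`ε = 1`) and homotopies (`ε = -1`) are both obtained from it. -/
theorem exists_lift (C E : BasedComplex σ 𝕜) {U : Set (σ →₀ ℕ)} (hE : E.Acyclic U) (s : ℕ) (ε : 𝕜)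
    (c : (C.ι →₀ 𝕜) →ₗ[𝕜] (E.ι →₀ 𝕜))
    (hc : ∀ x, E.d (c x) + ε • c (C.d x) = 0)
    (hj : ∀ j, (c (single j 1) = 0 ∧ C.d (single j 1) = 0) ∨
      (C.shift j ∈ U ∧ ∃ k, C.hdeg j + s = k + 1 ∧ c (single j 1) ∈ E.part k (C.shift j))) :
    ∃ T : (C.ι →₀ 𝕜) →ₗ[𝕜] (E.ι →₀ 𝕜),
      (∀ x, E.d (T x) = c x + ε • T (C.d x)) ∧
      (∀ j, T (single j 1) ∈ E.part (C.hdeg j + s) (C.shift j)) ∧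
      (∀ j, c (single j 1) = 0 → C.d (single j 1) = 0 → T (single j 1) = 0) := by
  set T : (C.ι →₀ 𝕜) →ₗ[𝕜] (E.ι →₀ 𝕜) := Finsupp.lsum 𝕜 fun j =>
    LinearMap.toSpanSingleton 𝕜 _ (liftFun C E s ε c j) with hT
  have hT1 : ∀ j, T (single j 1) = liftFun C E s ε c j := fun j => by simp [hT]
  have hTx : ∀ x, T x = ∑ l ∈ x.support.attach, x l.1 • liftFun C E s ε c l.1 := fun x => by
    rw [Finset.sum_attach x.support (fun l => x l • liftFun C E s ε c l)]
    simp [hT, Finsupp.sum]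
  have hTj : ∀ j, T (single j 1) = E.preimage (C.hdeg j + s) (C.shift j)
      (c (single j 1) + ε • T (C.d (single j 1))) := fun j => by
    rw [hT1, liftFun, hTx]
  have key : ∀ n j, C.hdeg j = n → T (single j 1) ∈ E.part (C.hdeg j + s) (C.shift j) ∧
      E.d (T (single j 1)) = c (single j 1) + ε • T (C.d (single j 1)) := by
    intro n
    induction n using Nat.strong_induction_on with
    | _ n ih =>
      intro j hjn
      rw [hTj j]
      apply E.preimage_spec
      rcases hj j with ⟨h1, h2⟩ | ⟨hU, k, hk, hck⟩
      · left; simp [h1, h2]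
      · right
        rw [hk]
        have hl : ∀ l, C.d (single j 1) l ≠ 0 → C.hdeg l + 1 = C.hdeg j ∧
          C.shift l ≤ C.shift j := C.d_single j
        apply hE _ hU k
        · refine add_mem hck (Submodule.smul_mem _ _ ?_)
          refine map_mem_of_single _ _ _ fun l h => ?_
          have := (ih (C.hdeg l) (by have := (hl l h).1; omega) l rfl).1
          rw [show C.hdeg l + s = k by have := (hl l h).1; omega] at this
          exact E.part_mono _ (hl l h).2 this
        · have h1 : E.d (T (C.d (single j 1))) = c (C.d (single j 1)) := by
            have := map_eq_of_single (E.d ∘ₗ T) (c + ε • (T ∘ₗ C.d)) (C.d (single j 1))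
              (fun l h => by
                simpa using (ih (C.hdeg l) (by have := (hl l h).1; omega) l rfl).2)
            simpa [C.d_d] using this
          rw [map_add, map_smul, h1, hc]
  refine ⟨T, fun x => ?_, fun j => (key _ j rfl).1, fun j h1 h2 => ?_⟩
  · have := map_eq_of_single (E.d ∘ₗ T) (c + ε • (T ∘ₗ C.d)) x
      (fun l _ => by simpa using (key _ l rfl).2)
    simpa using this
  · rw [hTj, h1, h2]; simp [preimage]

/-- A chain map that preserves multidegrees and maps `base` to `base`. -/
structure IsChainMap (C E : BasedComplex σ 𝕜) (f : (C.ι →₀ 𝕜) →ₗ[𝕜] (E.ι →₀ 𝕜)) : Prop where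
  comm : ∀ x, E.d (f x) = f (C.d x)
  mem : ∀ j, f (single j 1) ∈ E.part (C.hdeg j) (C.shift j)
  base : f (single C.base 1) = single E.base 1

theorem IsChainMap.mem_part {C E : BasedComplex σ 𝕜} {f : (C.ι →₀ 𝕜) →ₗ[𝕜] (E.ι →₀ 𝕜)}
    (hf : IsChainMap C E f) {k : ℕ} {a : σ →₀ ℕ} {x : C.ι →₀ 𝕜} (hx : x ∈ C.part k a) :
    f x ∈ E.part k a := by
  rw [BasedComplex.mem_part] at hx
  refine map_mem_of_single _ _ _ fun j hj => ?_
  have := hf.mem j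
  rw [(hx j hj).1] at this
  exact E.part_mono _ (hx j hj).2 this

theorem IsChainMap.comp {C E F : BasedComplex σ 𝕜} {f : (C.ι →₀ 𝕜) →ₗ[𝕜] (E.ι →₀ 𝕜)}
    {g : (E.ι →₀ 𝕜) →ₗ[𝕜] (F.ι →₀ 𝕜)} (hg : IsChainMap E F g) (hf : IsChainMap C E f) :
    IsChainMap C F (g ∘ₗ f) where
  comm x := by simp [hg.comm, hf.comm]
  mem j := hg.mem_part (hf.mem j)
  base := by simp [hf.base, hg.base]

theorem exists_isChainMap (C E : BasedComplex σ 𝕜) {U : Set (σ →₀ ℕ)} (hE : E.Acyclic U)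
    (hC : ∀ j, j ≠ C.base → C.shift j ∈ U) (h : E.shift E.base ≤ C.shift C.base) :
    ∃ f, IsChainMap C E f := by
  classical
  set θ : (C.ι →₀ 𝕜) →ₗ[𝕜] (E.ι →₀ 𝕜) :=
    Finsupp.lsingle E.base ∘ₗ Finsupp.lapply C.base with hθ
  have hθx : ∀ x, θ x = single E.base (x C.base) := fun x => by simp [hθ]
  obtain ⟨T, hT, hTm, hT0⟩ := exists_lift C E hE 0 1 (θ ∘ₗ C.d)
    (fun x => by simp [hθx, C.d_d]) (fun j => by
      by_cases hj : j = C.base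
      · left; subst hj; simp
      · right
        have h0 : C.hdeg j ≠ 0 := fun h0 => hj ((C.hdeg_eq_zero j).1 h0)
        refine ⟨hC j hj, C.hdeg j - 1, by omega, ?_⟩
        simp only [LinearMap.comp_apply, hθx]
        by_cases hb : C.d (single j 1) C.base = 0
        · simp [hb]
        · have := C.d_single j _ hb
          rw [hdeg_base] at this
          rw [← this.1]
          simpa using E.single_mem_part E.base _ (h.trans this.2))
  refine ⟨θ + T, fun x => ?_, fun j => ?_, ?_⟩
  · simp [hT, hθx]
  · refine add_mem ?_ (hTm j)
    rw [hθx]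
    by_cases hj : j = C.base
    · subst hj
      rw [hdeg_base]
      simpa using E.single_mem_part E.base _ h
    · simp [hj]
  · simp [hθx, hT0 C.base (by simp) (by simp)]

/-- Two chain maps into an acyclic complex are homotopic, so every multidegree of a minimal
complex occurs, in the same homological degree, in every other resolution. -/
theorem exists_shift_eq (F E : BasedComplex σ 𝕜) {U : Set (σ →₀ ℕ)} (hF : F.Acyclic U)
    (hE : E.Acyclic U) (hFU : ∀ j, j ≠ F.base → F.shift j ∈ U)
    (hEU : ∀ j, j ≠ E.base → E.shift j ∈ U) (hb : E.shift E.base = F.shift F.base)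
    (hmin : F.Minimal) (j : F.ι) :
    ∃ l : E.ι, E.hdeg l = F.hdeg j ∧ E.shift l = F.shift j := by
  classical
  obtain ⟨φ, hφ⟩ := exists_isChainMap F E hE hFU hb.le
  obtain ⟨ψ, hψ⟩ := exists_isChainMap E F hF hEU hb.ge
  have hψφ := hψ.comp hφ
  obtain ⟨h, hh, hhm, -⟩ := exists_lift F F hF 1 (-1)
    (LinearMap.id - ψ ∘ₗ φ) (fun x => by
      have := hψφ.comm x
      simp only [LinearMap.comp_apply] at this
      simp [this]) (fun j => by
      by_cases hj : j = F.base
      · left; subst hj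
        have := hψφ.base
        simp only [LinearMap.comp_apply] at this
        simp [this]
      · right
        refine ⟨hFU j hj, F.hdeg j, rfl, ?_⟩
        exact sub_mem (F.single_mem_part j 1 le_rfl) (hψφ.mem j))
  have e := hh (single j 1)
  -- By minimality neither term of the homotopy contributes to the coefficient of the basis element
  -- `j` itself, so this coefficient is the same in `ψ (φ j)` as in `j`.
  have e1 : F.d (h (single j 1)) j = 0 := by
    by_contra hne
    obtain ⟨l, hl, hl'⟩ := exists_apply_single_ne_zero _ hne
    exact hmin l j hl' (le_antisymm (F.d_single l j hl').2 (mem_part.1 (hhm j) l hl).2)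
  have e2 : h (F.d (single j 1)) j = 0 := by
    by_contra hne
    obtain ⟨l, hl, hl'⟩ := exists_apply_single_ne_zero _ hne
    exact hmin j l hl (le_antisymm (F.d_single j l hl).2 (mem_part.1 (hhm l) j hl').2)
  have e3 : (ψ (φ (single j 1))) j = 1 := by
    have := DFunLike.congr_fun e j
    simp [e1, e2] at this
    exact (sub_eq_zero.1 this.symm).symm
  obtain ⟨l, hl, hl'⟩ := exists_apply_single_ne_zero ψ (x := φ (single j 1)) (i := j)
    (by simp [e3])
  have h1 := mem_part.1 (hφ.mem j) l hl
  have h2 := mem_part.1 (hψ.mem l) j hl'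
  exact ⟨l, h1.1, le_antisymm h1.2 h2.2⟩

end BasedComplex

end

/-! ### Mapping cones and Koszul complexes -/

noncomputable section

open Finsupp

namespace BasedComplex

variable {σ 𝕜 : Type*} [Field 𝕜]

/-- The multidegrees of the basis elements of homological degree `k`. -/
def degs (C : BasedComplex σ 𝕜) (k : ℕ) : Set (σ →₀ ℕ) := {a | ∃ j, C.hdeg j = k ∧ C.shift j = a}

/-- `C` is a minimal resolution of the multigraded module with a one-dimensional component in
each multidegree `a ≥ p` outside the upper set `U`, and no others. For `p = 0` this module is
`S / I`, with `I` spanned by the monomials whose exponents lie in `U`. -/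
structure IsRes (C : BasedComplex σ 𝕜) (p : σ →₀ ℕ) (U : Set (σ →₀ ℕ)) : Prop where
  shift_base : C.shift C.base = p
  shift_mem : ∀ j, j ≠ C.base → C.shift j ∈ U
  acyclic : C.Acyclic U
  minimal : C.Minimal

/-- The differential `(x, y) ↦ (d x + f y, -d y)` of the mapping cone of `f`. -/
def coneD (E K : BasedComplex σ 𝕜) (f : (K.ι →₀ 𝕜) →ₗ[𝕜] (E.ι →₀ 𝕜)) :
    (E.ι ⊕ K.ι →₀ 𝕜) →ₗ[𝕜] (E.ι ⊕ K.ι →₀ 𝕜) :=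
  (sumFinsuppLEquivProdFinsupp 𝕜).symm.toLinearMap ∘ₗ
    ((E.d.coprod f).prod (-(K.d ∘ₗ LinearMap.snd 𝕜 _ _))) ∘ₗ
    (sumFinsuppLEquivProdFinsupp 𝕜).toLinearMap

theorem coneD_sumElim (E K : BasedComplex σ 𝕜) (f : (K.ι →₀ 𝕜) →ₗ[𝕜] (E.ι →₀ 𝕜)) (x : E.ι →₀ 𝕜)
    (y : K.ι →₀ 𝕜) : coneD E K f (sumElim x y) = sumElim (E.d x + f y) (-K.d y) := by
  have : sumFinsuppLEquivProdFinsupp 𝕜 (sumElim x y) = (x, y) :=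
    by
    ext j <;> simp
  simp only [coneD, LinearMap.comp_apply, LinearEquiv.coe_coe, this]
  rfl

theorem exists_eq_sumElim {α β M : Type*} [Zero M] (z : α ⊕ β →₀ M) :
    ∃ x y, z = sumElim x y := ⟨_, _, (comapDomain_sumElim_comapDomain z).symm⟩

theorem coneD_inl (E K : BasedComplex σ 𝕜) (f : (K.ι →₀ 𝕜) →ₗ[𝕜] (E.ι →₀ 𝕜)) (j : E.ι) :
    coneD E K f (single (Sum.inl j) 1) = sumElim (E.d (single j 1)) 0 := by
  rw [← sumElim_single_zero, coneD_sumElim]; simp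

theorem coneD_inr (E K : BasedComplex σ 𝕜) (f : (K.ι →₀ 𝕜) →ₗ[𝕜] (E.ι →₀ 𝕜)) (j : K.ι) :
    coneD E K f (single (Sum.inr j) 1) = sumElim (f (single j 1)) (-K.d (single j 1)) := by
  rw [← sumElim_zero_single, coneD_sumElim]; simp

/-- The mapping cone of a chain map. -/
@[reducible] def cone (E K : BasedComplex σ 𝕜) (f : (K.ι →₀ 𝕜) →ₗ[𝕜] (E.ι →₀ 𝕜))
    (hf : IsChainMap K E f) : BasedComplex σ 𝕜 where
  ι := E.ι ⊕ K.ι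
  hdeg := Sum.elim E.hdeg fun j => K.hdeg j + 1
  shift := Sum.elim E.shift K.shift
  d := coneD E K f
  d_d z := by
    obtain ⟨x, y, rfl⟩ := exists_eq_sumElim z
    simp [coneD_sumElim, E.d_d, K.d_d, hf.comm]
  d_single j l h := by
    rcases j with j | j <;> rcases l with l | l
    · rw [coneD_inl, sumElim_inl] at h
      exact E.d_single _ _ h
    · simp [coneD_inl] at h
    · rw [coneD_inr, sumElim_inl] at h
      simpa using mem_part.1 (hf.mem j) l h
    · simp only [coneD_inr, sumElim_inr, Finsupp.neg_apply, ne_eq, neg_eq_zero] at h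
      simpa using K.d_single _ _ h
  base := Sum.inl E.base
  hdeg_eq_zero j := by
    rcases j with j | j
    · simp [E.hdeg_eq_zero]
    · simp

theorem sumElim_mem_part_cone {E K : BasedComplex σ 𝕜} {f : (K.ι →₀ 𝕜) →ₗ[𝕜] (E.ι →₀ 𝕜)}
    {hf : IsChainMap K E f} {k : ℕ} {a : σ →₀ ℕ} {x : E.ι →₀ 𝕜} {y : K.ι →₀ 𝕜} :
    sumElim x y ∈ (cone E K f hf).part k a ↔
      x ∈ E.part k a ∧ ∀ j, y j ≠ 0 → K.hdeg j + 1 = k ∧ K.shift j ≤ a := by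
  rw [mem_part, mem_part]
  exact Sum.forall

theorem eq_single_base {C : BasedComplex σ 𝕜} {a : σ →₀ ℕ} {x : C.ι →₀ 𝕜} (h : x ∈ C.part 0 a) :
    x = single C.base (x C.base) := by
  rw [mem_part] at h
  rw [Finsupp.eq_single_iff]
  exact ⟨fun j hj => by
    simpa using (C.hdeg_eq_zero j).1 (h j (Finsupp.mem_support_iff.1 hj)).1, rfl⟩

theorem IsRes.part_eq_zero {C : BasedComplex σ 𝕜} {p : σ →₀ ℕ} {U : Set (σ →₀ ℕ)} (hC : C.IsRes p U)
    (hU : IsUpperSet U) {a : σ →₀ ℕ} (ha : a ∉ U) {k : ℕ} {x : C.ι →₀ 𝕜}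
    (hx : x ∈ C.part (k + 1) a) : x = 0 := by
  rw [mem_part] at hx
  ext j
  by_contra hj
  obtain ⟨h1, h2⟩ := hx j hj
  refine ha (hU h2 (hC.shift_mem j fun e => ?_))
  rw [e, hdeg_base] at h1
  omega

/-- If `E` and `K` resolve the modules with components in the multidegrees of `{a ≥ p} \ U` and
`{a ≥ q} \ U`, and `p ≤ q`, then a cone resolves the cokernel of the inclusion of the second module
into the first. -/
theorem cone_acyclic {E K : BasedComplex σ 𝕜} {p q : σ →₀ ℕ} {U W : Set (σ →₀ ℕ)}
    (hE : E.IsRes p U) (hK : K.IsRes q W) (hU : IsUpperSet U) (hW : ∀ a, a ∈ W ↔ q ≤ a ∧ a ∈ U)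
    {f : (K.ι →₀ 𝕜) →ₗ[𝕜] (E.ι →₀ 𝕜)} (hf : IsChainMap K E f) :
    (cone E K f hf).Acyclic (U ∪ Set.Ici q) := by
  have hWU : IsUpperSet W := fun a b hab ha =>
    (hW b).2 ⟨((hW a).1 ha).1.trans hab, hU hab ((hW a).1 ha).2⟩
  have hKq : ∀ j, q ≤ K.shift j := fun j => by
    by_cases hj : j = K.base
    · rw [hj, hK.shift_base]
    · exact ((hW _).1 (hK.shift_mem j hj)).1
  intro a ha k z hz hdz
  obtain ⟨x, y, rfl⟩ := exists_eq_sumElim z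
  rw [sumElim_mem_part_cone] at hz
  obtain ⟨hx, hy⟩ := hz
  have hd : E.d x + f y = 0 ∧ K.d y = 0 := by
    have : coneD E K f (sumElim x y) = 0 := hdz
    rw [coneD_sumElim] at this
    constructor
    · ext j; simpa using DFunLike.congr_fun this (Sum.inl j)
    · ext j; simpa using DFunLike.congr_fun this (Sum.inr j)
  by_cases haU : a ∈ U
  · obtain ⟨y', hy', hdy'⟩ : ∃ y' ∈ K.part k a, K.d y' = y := by
      by_cases hya : y = 0
      · exact ⟨0, zero_mem _, by simp [hya]⟩
      · obtain ⟨j, hj⟩ := Finsupp.ne_iff.1 hya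
        obtain ⟨h1, h2⟩ := hy j hj
        subst h1
        refine hK.acyclic a ((hW a).2 ⟨(hKq j).trans h2, haU⟩) _ y ?_ hd.2
        rw [mem_part]
        exact fun l hl => ⟨by have := (hy l hl).1; omega, (hy l hl).2⟩
    obtain ⟨x', hx', hdx'⟩ := hE.acyclic a haU k (x + f y') (add_mem hx (hf.mem_part hy')) (by
      rw [map_add, hf.comm, hdy', hd.1])
    refine ⟨sumElim x' (-y'), sumElim_mem_part_cone.2 ⟨hx', fun j hj => ?_⟩, ?_⟩
    · have := mem_part.1 hy' j (by simpa using hj)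
      exact ⟨by omega, this.2⟩
    · change coneD E K f _ = _
      rw [coneD_sumElim, hdx', map_neg, map_neg, hdy']
      simp
  · -- In these multidegrees both complexes are spanned by their basis elements `base`.
    have haq : q ≤ a := ha.resolve_left haU
    have haW : a ∉ W := fun h => haU ((hW a).1 h).2
    match k with
    | 0 =>
      have hy0 : y = 0 := by
        ext j; by_contra hj; have := (hy j hj).1; omega
      subst hy0
      refine ⟨sumElim 0 (single K.base (x E.base)), sumElim_mem_part_cone.2
        ⟨zero_mem _, fun j hj => ?_⟩, ?_⟩
      · have hj : j = K.base := by
          by_contra h; simp [h] at hj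
        rw [hj, hdeg_base, hK.shift_base]
        exact ⟨rfl, haq⟩
      · change coneD E K f _ = _
        rw [coneD_sumElim, d_base]
        have : single K.base (x E.base) = x E.base • single K.base (1 : 𝕜) := by simp
        rw [this, map_smul, hf.base]
        conv_rhs => rw [eq_single_base hx]
        simp
    | k + 1 =>
      have hx0 : x = 0 := hE.part_eq_zero hU haU hx
      have hyk : y ∈ K.part k a := by
        rw [mem_part]
        exact fun l hl => ⟨by have := (hy l hl).1; omega, (hy l hl).2⟩
      have hy0 : y = 0 := by
        match k with
        | 0 =>
          have h1 := hd.1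
          rw [hx0, eq_single_base hyk] at h1
          have : single K.base (y K.base) = y K.base • single K.base (1 : 𝕜) := by simp
          rw [this, map_smul, hf.base] at h1
          have h2 : y K.base = 0 := by simpa using h1
          rw [eq_single_base hyk, h2, single_zero]
        | k + 1 => exact hK.part_eq_zero hWU haW hyk
      exact ⟨0, zero_mem _, by simp [hx0, hy0]⟩

theorem cone_minimal {E K : BasedComplex σ 𝕜} (hE : E.Minimal) (hK : K.Minimal)
    {f : (K.ι →₀ 𝕜) →ₗ[𝕜] (E.ι →₀ 𝕜)} (hf : IsChainMap K E f)
    (h : ∀ i j, E.hdeg i = K.hdeg j → E.shift i ≠ K.shift j) : (cone E K f hf).Minimal := by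
  intro j l hjl
  change coneD E K f _ _ ≠ 0 at hjl
  rcases j with j | j <;> rcases l with l | l
  · rw [coneD_inl, sumElim_inl] at hjl
    exact hE _ _ hjl
  · simp [coneD_inl] at hjl
  · rw [coneD_inr, sumElim_inl] at hjl
    exact h l j (mem_part.1 (hf.mem j) l hjl).1
  · simp only [coneD_inr, sumElim_inr, Finsupp.neg_apply, ne_eq, neg_eq_zero] at hjl
    exact hK _ _ hjl

end BasedComplex

open BasedComplex

/-- There is a finite minimal resolution of the module determined by `p` and `U`, with `D k` the
set of multidegrees of its basis elements in homological degree `k`. -/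
def HasRes {σ : Type*} (𝕜 : Type*) [Field 𝕜] (p : σ →₀ ℕ) (U : Set (σ →₀ ℕ))
    (D : ℕ → Set (σ →₀ ℕ)) : Prop :=
  ∃ C : BasedComplex σ 𝕜, Finite C.ι ∧ C.IsRes p U ∧ ∀ k, C.degs k = D k

variable {σ 𝕜 : Type*} [Field 𝕜]

theorem HasRes.cone {p q : σ →₀ ℕ} {U W : Set (σ →₀ ℕ)} {D D' : ℕ → Set (σ →₀ ℕ)}
    (hE : HasRes 𝕜 p U D) (hK : HasRes 𝕜 q W D') (hU : IsUpperSet U) (hpq : p ≤ q)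
    (hW : ∀ a, a ∈ W ↔ q ≤ a ∧ a ∈ U) (h : ∀ k a, a ∈ D k → a ∉ D' k) :
    HasRes 𝕜 p (U ∪ Set.Ici q) fun k => D k ∪ {a | ∃ i, i + 1 = k ∧ a ∈ D' i} := by
  obtain ⟨E, hEf, hE, hED⟩ := hE
  obtain ⟨K, hKf, hK, hKD⟩ := hK
  obtain ⟨f, hf⟩ := exists_isChainMap K E hE.acyclic
    (fun j hj => ((hW _).1 (hK.shift_mem j hj)).2) (by rwa [hE.shift_base, hK.shift_base])
  refine ⟨E.cone K f hf, inferInstanceAs (Finite (E.ι ⊕ K.ι)), ⟨hE.shift_base, ?_,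
    cone_acyclic hE hK hU hW hf, cone_minimal hE.minimal hK.minimal hf ?_⟩, ?_⟩
  · rintro (j | j) hj
    · exact Or.inl (hE.shift_mem j fun e => hj (congrArg Sum.inl e))
    · right
      change q ≤ K.shift j
      by_cases hj : j = K.base
      · rw [hj, hK.shift_base]
      · exact ((hW _).1 (hK.shift_mem j hj)).1
  · intro i j hij e
    refine h (K.hdeg j) (K.shift j) ?_ ?_
    · rw [← hED]; exact ⟨i, hij, e⟩
    · rw [← hKD]; exact ⟨j, rfl, rfl⟩
  · intro k
    ext a
    simp only [← hED, ← hKD, degs, Set.mem_union, Set.mem_ofPred_eq]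
    constructor
    · rintro ⟨j | j, h1, h2⟩
      · exact Or.inl ⟨j, h1, h2⟩
      · exact Or.inr ⟨_, h1, j, rfl, h2⟩
    · rintro (⟨j, h1, h2⟩ | ⟨i, h0, j, h1, h2⟩)
      · exact ⟨Sum.inl j, h1, h2⟩
      · exact ⟨Sum.inr j, by subst h1; exact h0, h2⟩

theorem HasRes.congr {p : σ →₀ ℕ} {U U' : Set (σ →₀ ℕ)} {D D' : ℕ → Set (σ →₀ ℕ)}
    (h : HasRes 𝕜 p U D) (hU : U = U') (hD : ∀ k a, a ∈ D k ↔ a ∈ D' k) : HasRes 𝕜 p U' D' := by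
  obtain ⟨C, h1, h2, h3⟩ := h
  exact ⟨C, h1, hU ▸ h2, fun k => (h3 k).trans (Set.ext (hD k))⟩

theorem hasRes_empty (p : σ →₀ ℕ) : HasRes 𝕜 p ∅ fun k => {a | k = 0 ∧ a = p} := by
  let C : BasedComplex σ 𝕜 := ⟨Unit, fun _ => 0, fun _ => p, 0, by simp, by simp, (), by simp⟩
  refine ⟨C, inferInstanceAs (Finite Unit), ⟨rfl, fun j hj => (hj rfl).elim,
    fun a ha => ha.elim, fun j l h => (h rfl).elim⟩, fun k => ?_⟩
  ext a
  simp [degs, C, eq_comm]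

/-- The exponent of the squarefree monomial with support `B`. -/
def ind (B : Finset σ) : σ →₀ ℕ := ∑ v ∈ B, single v 1

theorem ind_apply [DecidableEq σ] (B : Finset σ) (v : σ) : ind B v = if v ∈ B then 1 else 0 := by
  simp [ind, Finsupp.finsetSum_apply, Finsupp.single_apply]

theorem ind_insert [DecidableEq σ] {B : Finset σ} {v : σ} (hv : v ∉ B) :
    ind (insert v B) = single v 1 + ind B := by
  simp [ind, hv]

theorem degree_ind (B : Finset σ) : (ind B).degree = B.card := by
  simp [ind, map_sum]

/-- The Koszul complex on the variables indexed by `A`, with its generator in multidegree `q`. -/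
theorem hasRes_koszul (A : Finset σ) (q : σ →₀ ℕ) :
    HasRes 𝕜 q {a | q ≤ a ∧ ∃ u ∈ A, q u < a u}
      fun k => {a | ∃ B ⊆ A, B.card = k ∧ a = q + ind B} := by
  classical
  induction A using Finset.induction_on generalizing q with
  | empty =>
    refine (hasRes_empty q).congr (by simp) fun k a => ?_
    simp only [Set.mem_ofPred_eq, Finset.subset_empty]
    constructor
    · rintro ⟨rfl, rfl⟩
      exact ⟨∅, rfl, rfl, by simp [ind]⟩
    · rintro ⟨B, rfl, rfl, rfl⟩
      simp [ind]
  | insert v A hv ih =>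
    have hup : IsUpperSet {a : σ →₀ ℕ | q ≤ a ∧ ∃ u ∈ A, q u < a u} := by
      rintro a b hab ⟨h1, u, hu, h2⟩
      exact ⟨h1.trans hab, u, hu, h2.trans_le (hab u)⟩
    refine ((ih q).cone (ih (q + single v 1)) hup le_self_add ?_ ?_).congr ?_ ?_
    · intro a
      simp only [Set.mem_ofPred_eq]
      have : ∀ u ∈ A, (q + single v 1 : σ →₀ ℕ) u = q u := fun u hu => by
        have : v ≠ u := fun e => hv (e ▸ hu)
        simp [this]
      constructor
      · rintro ⟨h1, u, hu, h2⟩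
        exact ⟨h1, le_self_add.trans h1, u, hu, by rwa [this u hu] at h2⟩
      · rintro ⟨h1, -, u, hu, h2⟩
        exact ⟨h1, u, hu, by rwa [this u hu]⟩
    · rintro k a ⟨B, -, hB, rfl⟩ ⟨B', -, hB', e⟩
      have := congrArg Finsupp.degree e
      simp [map_add, degree_ind] at this
      omega
    · ext a
      simp only [Set.mem_union, Set.mem_ofPred_eq, Set.mem_Ici, Finset.mem_insert]
      have key : q + single v 1 ≤ a ↔ q ≤ a ∧ q v < a v := by
        constructor
        · intro h
          refine ⟨le_self_add.trans h, ?_⟩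
          have := h v
          simp at this
          omega
        · rintro ⟨h1, h2⟩ u
          have := h1 u
          by_cases e : v = u
          · subst e; simp; omega
          · simpa [Finsupp.single_apply, e] using this
      rw [key]
      constructor
      · rintro (⟨h1, u, hu, h2⟩ | ⟨h1, h2⟩)
        · exact ⟨h1, u, Or.inr hu, h2⟩
        · exact ⟨h1, v, Or.inl rfl, h2⟩
      · rintro ⟨h1, u, rfl | hu, h2⟩
        · exact Or.inr ⟨h1, h2⟩
        · exact Or.inl ⟨h1, u, hu, h2⟩
    · intro k a
      simp only [Set.mem_union, Set.mem_ofPred_eq]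
      constructor
      · rintro (⟨B, hB, h1, h2⟩ | ⟨i, hi, B, hB, h1, rfl⟩)
        · exact ⟨B, hB.trans (Finset.subset_insert _ _), h1, h2⟩
        · have : v ∉ B := fun h => hv (hB h)
          refine ⟨insert v B, Finset.insert_subset_insert _ hB, ?_, ?_⟩
          · rw [Finset.card_insert_of_notMem this]; omega
          · rw [ind_insert this, add_assoc]
      · rintro ⟨B, hB, h1, rfl⟩
        by_cases hvB : v ∈ B
        · right
          have hv' : v ∉ B.erase v := by simp
          refine ⟨(B.erase v).card, ?_, B.erase v, ?_, rfl, ?_⟩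
          · rw [Finset.card_erase_add_one hvB, h1]
          · exact Finset.subset_insert_iff.1 hB
          · rw [add_assoc, ← ind_insert hv', Finset.insert_erase hvB]
        · left
          exact ⟨B, (Finset.subset_insert_iff_of_notMem hvB).1 hB, h1, rfl⟩

/-- An ideal generated by monomials of degree two, which has linear quotients with respect to
the order of the generators `q e` given by `f`, is resolved by the iterated mapping cone of the
Koszul complexes on the variables `A e` that generate the successive colon ideals. -/
theorem hasRes_of_linearQuotients {ε α : Type*} [LinearOrder α] (f : ε → α)
    (hf : Function.Injective f) (T : Finset ε) (q : ε → (σ →₀ ℕ)) (A : ε → Finset σ)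
    (hq : ∀ e ∈ T, (q e).degree = 2)
    (h : ∀ e ∈ T, ∀ a, q e ≤ a →
      ((∃ e' ∈ T, f e' < f e ∧ q e' ≤ a) ↔ ∃ u ∈ A e, q e u < a u)) :
    HasRes 𝕜 0 {a | ∃ e ∈ T, q e ≤ a} fun k => {a | (k = 0 ∧ a = 0) ∨
      ∃ e ∈ T, ∃ B ⊆ A e, B.card + 1 = k ∧ a = q e + ind B} := by
  classical
  suffices H : ∀ s : Finset ε, s ⊆ T → (∀ e ∈ s, ∀ e' ∈ T, f e' < f e → e' ∈ s) →
      HasRes 𝕜 0 {a | ∃ e ∈ s, q e ≤ a} fun k => {a | (k = 0 ∧ a = 0) ∨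
        ∃ e ∈ s, ∃ B ⊆ A e, B.card + 1 = k ∧ a = q e + ind B} from
    H T (Finset.Subset.refl _) fun _ _ e' he' _ => he'
  intro s
  induction s using Finset.induction_on_max_value f with
  | empty =>
    intro _ _
    exact (hasRes_empty 0).congr (by simp) fun k a => by simp
  | insert e s hes hmax ih =>
    intro hsT hdown
    have heT : e ∈ T := hsT (Finset.mem_insert_self _ _)
    have hlt : ∀ x ∈ s, f x < f e := fun x hx =>
      (hmax x hx).lt_of_ne fun hxe => hes (hf hxe ▸ hx)
    have ih := ih ((Finset.subset_insert _ _).trans hsT) fun x hx y hy hyx =>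
      (Finset.mem_insert.1 (hdown x (Finset.mem_insert_of_mem hx) y hy hyx)).resolve_left
        fun hye => (hyx.trans (hlt x hx)).ne (by rw [hye])
    have hs : ∀ y, y ∈ s ↔ y ∈ T ∧ f y < f e := fun y =>
      ⟨fun hy => ⟨hsT (Finset.mem_insert_of_mem hy), hlt y hy⟩, fun hy =>
        (Finset.mem_insert.1 (hdown e (Finset.mem_insert_self _ _) y hy.1 hy.2)).resolve_left
          fun hye => hy.2.ne (by rw [hye])⟩
    have hup : IsUpperSet {a : σ →₀ ℕ | ∃ e ∈ s, q e ≤ a} := by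
      rintro a b hab ⟨x, hx, h1⟩
      exact ⟨x, hx, h1.trans hab⟩
    refine (ih.cone (hasRes_koszul (A e) (q e)) hup (zero_le (a := q e)) ?_ ?_).congr ?_ ?_
    · intro a
      simp only [Set.mem_ofPred_eq, and_congr_right_iff]
      intro ha
      rw [← h e heT a ha]
      simp [hs, and_assoc]
    · rintro k a ha ⟨B', -, hB', rfl⟩
      rcases ha with ⟨hk, ha⟩ | ⟨x, hx, B, -, hB, ha⟩
      · have := congrArg Finsupp.degree ha
        simp only [map_add, degree_ind, hq e heT, map_zero] at this
        omega
      · have := congrArg Finsupp.degree ha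
        simp only [map_add, degree_ind, hq e heT, hq x (hsT (Finset.mem_insert_of_mem hx))]
          at this
        omega
    · ext a
      simp [or_comm]
    · intro k a
      simp only [Set.mem_union, Set.mem_ofPred_eq, Finset.exists_mem_insert]
      constructor
      · rintro ((h1 | h1) | ⟨i, hi, B, hB, h1, h2⟩)
        · exact Or.inl h1
        · exact Or.inr (Or.inr h1)
        · exact Or.inr (Or.inl ⟨B, hB, by omega, h2⟩)
      · rintro (h1 | ⟨B, hB, h1, h2⟩ | h1)
        · exact Or.inl (Or.inl h1)
        · exact Or.inr ⟨_, h1, B, hB, rfl, h2⟩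
        · exact Or.inl (Or.inr h1)

end

/-! ### Dehomogenization -/

noncomputable section

open MvPolynomial

section Component

variable {σ 𝕜 ι κ : Type*} [Field 𝕜]

open Classical in
/-- The component of multidegree `a` of a vector of `⨁ₗ S(-s l)`, with all variables set to
`1`. -/
def component (s : ι → (σ →₀ ℕ)) (a : σ →₀ ℕ) :
    (ι →₀ MvPolynomial σ 𝕜) →ₗ[𝕜] (ι →₀ 𝕜) :=
  Finsupp.lsum 𝕜 fun l =>
    if s l ≤ a then Finsupp.lsingle l ∘ₗ MvPolynomial.lcoeff 𝕜 (a - s l) else 0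

open Classical in
theorem component_apply (s : ι → (σ →₀ ℕ)) (a : σ →₀ ℕ) (v : ι →₀ MvPolynomial σ 𝕜) (l : ι) :
    component s a v l = if s l ≤ a then coeff (a - s l) (v l) else 0 := by
  induction v using Finsupp.induction_linear with
  | zero => simp
  | add f g hf hg =>
    rw [map_add, Finsupp.add_apply, hf, hg, Finsupp.add_apply]
    split_ifs <;> simp
  | single j p =>
    simp only [component, Finsupp.lsum_apply]
    rw [Finsupp.sum_single_index (by simp)]
    by_cases hjl : j = l
    · subst hjl
      split_ifs <;> simp [MvPolynomial.lcoeff]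
    · split_ifs <;> simp [hjl]

theorem le_of_component_ne_zero {s : ι → (σ →₀ ℕ)} {a : σ →₀ ℕ} {v : ι →₀ MvPolynomial σ 𝕜}
    {l : ι} (h : component s a v l ≠ 0) : s l ≤ a := by
  by_contra h'
  simp [component_apply, h'] at h

theorem eq_of_component_eq {s : ι → (σ →₀ ℕ)} {v w : ι →₀ MvPolynomial σ 𝕜}
    (h : ∀ a, component s a v = component s a w) : v = w := by
  ext l m
  have := DFunLike.congr_fun (h (m + s l)) l
  simpa [component_apply] using this

/-- The homogeneous vector of multidegree `a` that becomes `w` when all variables are set to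
`1`. -/
def homogenize (s : ι → (σ →₀ ℕ)) (a : σ →₀ ℕ) :
    (ι →₀ 𝕜) →ₗ[𝕜] (ι →₀ MvPolynomial σ 𝕜) :=
  Finsupp.lsum 𝕜 fun l => Finsupp.lsingle l ∘ₗ monomial (a - s l)

theorem homogenize_single (s : ι → (σ →₀ ℕ)) (a : σ →₀ ℕ) (l : ι) (c : 𝕜) :
    homogenize s a (Finsupp.single l c) = Finsupp.single l (monomial (a - s l) c) := by
  simp [homogenize]

theorem homogenize_apply (s : ι → (σ →₀ ℕ)) (a : σ →₀ ℕ) (w : ι →₀ 𝕜) (l : ι) :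
    homogenize s a w l = monomial (a - s l) (w l) := by
  classical
  induction w using Finsupp.induction_linear with
  | zero => simp
  | add f g hf hg => rw [map_add, Finsupp.add_apply, hf, hg, Finsupp.add_apply, map_add]
  | single j p =>
    rw [homogenize_single]
    by_cases hjl : j = l
    · subst hjl; simp
    · simp [hjl]

open Classical in
theorem component_homogenize {s : ι → (σ →₀ ℕ)} {a : σ →₀ ℕ} {w : ι →₀ 𝕜}
    (hw : ∀ l, w l ≠ 0 → s l ≤ a) (b : σ →₀ ℕ) :
    component s b (homogenize s a w) = if a = b then w else 0 := by
  ext l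
  rw [component_apply, homogenize_apply]
  by_cases hl : w l = 0
  · split_ifs <;> simp [hl]
  · have hla := hw l hl
    by_cases hb : s l ≤ b
    · have : a - s l = b - s l ↔ a = b := tsub_left_inj hla hb
      rw [if_pos hb, coeff_monomial]
      simp only [this]
      split_ifs <;> simp
    · have : a ≠ b := fun e => hb (e ▸ hla)
      simp [hb, this]

theorem isMultihomogeneous_homogenize {s : ι → (σ →₀ ℕ)} {a : σ →₀ ℕ} {w : ι →₀ 𝕜}
    (hw : ∀ l, w l ≠ 0 → s l ≤ a) : IsMultihomogeneous s a (homogenize s a w) := by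
  classical
  intro l m hm
  rw [homogenize_apply, mem_support_iff, coeff_monomial] at hm
  by_cases h : a - s l = m
  · rw [if_pos h] at hm
    rw [← h, tsub_add_cancel_of_le (hw l hm)]
  · simp [h] at hm

theorem IsMultihomogeneous.eq_homogenize {s : ι → (σ →₀ ℕ)} {a : σ →₀ ℕ}
    {v : ι →₀ MvPolynomial σ 𝕜} (hv : IsMultihomogeneous s a v) :
    v = homogenize s a (component s a v) := by
  classical
  ext l m
  rw [homogenize_apply, component_apply, coeff_monomial]
  by_cases hm : coeff m (v l) = 0
  · split_ifs with h1 h2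
    · rw [h1]
    · rw [hm]
    · rw [hm]
  · have := hv l m (mem_support_iff.2 hm)
    subst this
    simp

open Classical in
theorem component_monomial_smul {s : ι → (σ →₀ ℕ)} {b : σ →₀ ℕ} {v : ι →₀ MvPolynomial σ 𝕜}
    (hv : IsMultihomogeneous s b v) (m : σ →₀ ℕ) (c : 𝕜) (a : σ →₀ ℕ) :
    component s a (monomial m c • v) = if m + b = a then c • component s b v else 0 := by
  have h1 : monomial m c • v = homogenize s (m + b) (c • component s b v) := by
    ext1 l
    rw [hv.eq_homogenize]
    simp only [Finsupp.smul_apply, homogenize_apply, smul_eq_mul, monomial_mul]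
    by_cases h : s l ≤ b
    · rw [add_tsub_assoc_of_le h, component_homogenize fun _ => le_of_component_ne_zero, if_pos rfl]
    · have : component s b v l = 0 := by simp [component_apply, h]
      rw [component_homogenize fun _ => le_of_component_ne_zero, if_pos rfl]
      simp [this]
  rw [h1, component_homogenize]
  intro l hl
  have : component s b v l ≠ 0 := fun h => hl (by simp [h])
  exact (le_of_component_ne_zero this).trans le_add_self

/-- The matrix of a homogeneous map of free modules, with all variables set to `1`. -/
def dehomogenize (s : ι → (σ →₀ ℕ)) (t : κ → (σ →₀ ℕ))
    (f : (ι →₀ MvPolynomial σ 𝕜) →ₗ[MvPolynomial σ 𝕜] (κ →₀ MvPolynomial σ 𝕜)) :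
    (ι →₀ 𝕜) →ₗ[𝕜] (κ →₀ 𝕜) :=
  Finsupp.lsum 𝕜 fun j => LinearMap.toSpanSingleton 𝕜 _ (component t (s j) (f (Finsupp.single j 1)))

theorem dehomogenize_single (s : ι → (σ →₀ ℕ)) (t : κ → (σ →₀ ℕ))
    (f : (ι →₀ MvPolynomial σ 𝕜) →ₗ[MvPolynomial σ 𝕜] (κ →₀ MvPolynomial σ 𝕜)) (j : ι) (c : 𝕜) :
    dehomogenize s t f (Finsupp.single j c) = c • component t (s j) (f (Finsupp.single j 1)) := by
  simp [dehomogenize]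

/-- If all basis vectors are mapped to homogeneous vectors of the right multidegrees, taking
components commutes with the map. -/
theorem component_map {s : ι → (σ →₀ ℕ)} {t : κ → (σ →₀ ℕ)}
    {f : (ι →₀ MvPolynomial σ 𝕜) →ₗ[MvPolynomial σ 𝕜] (κ →₀ MvPolynomial σ 𝕜)}
    (hf : ∀ j, IsMultihomogeneous t (s j) (f (Finsupp.single j 1))) (a : σ →₀ ℕ)
    (v : ι →₀ MvPolynomial σ 𝕜) :
    component t a (f v) = dehomogenize s t f (component s a v) := by
  classical
  induction v using Finsupp.induction_linear with
  | zero => simp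
  | add f g hf hg => simp only [map_add, hf, hg]
  | single j p =>
    induction p using MvPolynomial.induction_on' with
    | add p q hp hq => rw [Finsupp.single_add]; simp only [map_add, hp, hq]
    | monomial m c =>
      have h1 : (Finsupp.single j (monomial m c) : ι →₀ MvPolynomial σ 𝕜) =
          monomial m c • Finsupp.single j 1 := by simp
      have h2 : component s a (Finsupp.single j (monomial m c)) =
          if m + s j = a then Finsupp.single j c else 0 := by
        have := component_homogenize (s := s) (a := m + s j) (w := Finsupp.single j c)
          (fun l hl => by
            have : j = l := by by_contra h; simp [h] at hl
            exact this ▸ le_add_self) a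
        rwa [homogenize_single, add_tsub_cancel_right] at this
      rw [h2, h1, map_smul, component_monomial_smul (hf j)]
      split_ifs
      · rw [dehomogenize_single]
      · rw [map_zero]

end Component

/-! ### From minimal free resolutions to based complexes -/

namespace MinimalFreeResolution

variable {σ 𝕜 : Type*} [Field 𝕜] {I : Ideal (MvPolynomial σ 𝕜)}

/-- The bases of the resolution `⋯ → F 1 → F 0 → S` of `S / I`. -/
def idx (F : MinimalFreeResolution I) : ℕ → Type
  | 0 => Unit
  | k + 1 => F.ι k

/-- The multidegrees of the basis elements of the resolution of `S / I`. -/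
def sh (F : MinimalFreeResolution I) : (k : ℕ) → F.idx k → (σ →₀ ℕ)
  | 0, _ => 0
  | k + 1, j => F.shift k j

/-- The differentials of the resolution of `S / I`. -/
def diff (F : MinimalFreeResolution I) : (k : ℕ) →
    (F.idx (k + 1) →₀ MvPolynomial σ 𝕜) →ₗ[MvPolynomial σ 𝕜] (F.idx k →₀ MvPolynomial σ 𝕜)
  | 0 => Finsupp.lsingle () ∘ₗ F.aug
  | k + 1 => F.d k

theorem diff_homogeneous (F : MinimalFreeResolution I) (k : ℕ) (j : F.idx (k + 1)) :
    IsMultihomogeneous (F.sh k) (F.sh (k + 1) j) (F.diff k (Finsupp.single j 1)) := by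
  cases k with
  | zero =>
    intro l m hm
    have e : F.diff 0 (Finsupp.single j 1) l = F.aug (Finsupp.single j 1) := by
      change Finsupp.single () (F.aug (Finsupp.single j 1)) l = _
      exact Finsupp.single_eq_same
    rw [e] at hm
    exact (add_zero m).trans (F.aug_homogeneous j m hm)
  | succ k => exact F.d_homogeneous k j

theorem diff_exact (F : MinimalFreeResolution I) (k : ℕ)
    (v : F.idx (k + 1) →₀ MvPolynomial σ 𝕜) :
    F.diff k v = 0 ↔ ∃ w, F.diff (k + 1) w = v := by
  cases k with
  | zero =>
    have h : F.diff 0 v = 0 ↔ v ∈ LinearMap.ker F.aug := by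
      change Finsupp.single () (F.aug v) = 0 ↔ F.aug v = 0
      rw [Finsupp.single_eq_zero]
    rw [h, ← F.exact_aug]
    rfl
  | succ k =>
    have h : F.diff (k + 1) v = 0 ↔ v ∈ LinearMap.ker (F.d k) := Iff.rfl
    rw [h, ← F.exact]
    rfl

theorem coeff_zero_of_mem_smul_top {ι : Type*} {v : ι →₀ MvPolynomial σ 𝕜}
    (hv : v ∈ Ideal.span (Set.range (X : σ → MvPolynomial σ 𝕜)) •
      (⊤ : Submodule (MvPolynomial σ 𝕜) (ι →₀ MvPolynomial σ 𝕜))) (l : ι) :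
    coeff 0 (v l) = 0 := by
  have h0 : ∀ f ∈ Ideal.span (Set.range (X : σ → MvPolynomial σ 𝕜)), coeff 0 f = 0 := by
    intro f hf
    have : Ideal.span (Set.range (X : σ → MvPolynomial σ 𝕜)) ≤ RingHom.ker constantCoeff := by
      rw [Ideal.span_le]
      rintro _ ⟨i, rfl⟩
      simp
    exact this hf
  refine Submodule.smul_induction_on hv (fun r hr n _ => ?_) fun x y hx hy => by simp [hx, hy]
  rw [Finsupp.smul_apply]
  exact h0 _ (Ideal.mul_mem_right _ _ hr)

theorem diff_minimal (F : MinimalFreeResolution I) (k : ℕ)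
    (v : F.idx (k + 2) →₀ MvPolynomial σ 𝕜) (l : F.idx (k + 1)) :
    coeff 0 (F.diff (k + 1) v l) = 0 :=
  coeff_zero_of_mem_smul_top (F.minimal k ⟨v, rfl⟩) l

/-- The differentials of the resolution of `S / I`, dehomogenized. -/
def scalarDiff (F : MinimalFreeResolution I) (k : ℕ) : (F.idx (k + 1) →₀ 𝕜) →ₗ[𝕜] (F.idx k →₀ 𝕜) :=
  dehomogenize (F.sh (k + 1)) (F.sh k) (F.diff k)

theorem component_diff (F : MinimalFreeResolution I) (k : ℕ) (a : σ →₀ ℕ)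
    (v : F.idx (k + 1) →₀ MvPolynomial σ 𝕜) :
    component (F.sh k) a (F.diff k v) = F.scalarDiff k (component (F.sh (k + 1)) a v) :=
  component_map (F.diff_homogeneous k) a v

theorem scalarDiff_single (F : MinimalFreeResolution I) (k : ℕ) (j : F.idx (k + 1)) :
    F.scalarDiff k (Finsupp.single j 1) =
      component (F.sh k) (F.sh (k + 1) j) (F.diff k (Finsupp.single j 1)) := by
  rw [scalarDiff, dehomogenize_single, one_smul]

theorem scalarDiff_scalarDiff (F : MinimalFreeResolution I) (k : ℕ) (w : F.idx (k + 2) →₀ 𝕜) :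
    F.scalarDiff k (F.scalarDiff (k + 1) w) = 0 := by
  have := map_eq_of_single (F.scalarDiff k ∘ₗ F.scalarDiff (k + 1)) 0 w fun j _ => by
    rw [LinearMap.comp_apply, scalarDiff_single, ← component_diff,
      (F.diff_exact k _).2 ⟨_, rfl⟩, map_zero, LinearMap.zero_apply]
  simpa using this

/-- The differential of the dehomogenized resolution, on the sum of all homological degrees. -/
def totalDiff (F : MinimalFreeResolution I) :
    ((Σ k, F.idx k) →₀ 𝕜) →ₗ[𝕜] ((Σ k, F.idx k) →₀ 𝕜) :=
  Finsupp.lsum 𝕜 fun x => match x with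
    | ⟨0, _⟩ => 0
    | ⟨k + 1, j⟩ => LinearMap.toSpanSingleton 𝕜 _
        (Finsupp.mapDomain (Sigma.mk k) (F.scalarDiff k (Finsupp.single j 1)))

theorem totalDiff_zero (F : MinimalFreeResolution I) (j : F.idx 0) (c : 𝕜) :
    F.totalDiff (Finsupp.single ⟨0, j⟩ c) = 0 := by
  simp [totalDiff]

theorem totalDiff_succ (F : MinimalFreeResolution I) (k : ℕ) (w : F.idx (k + 1) →₀ 𝕜) :
    F.totalDiff (Finsupp.mapDomain (Sigma.mk (k + 1)) w) =
      Finsupp.mapDomain (Sigma.mk k) (F.scalarDiff k w) := by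
  refine map_eq_of_single (F.totalDiff ∘ₗ Finsupp.lmapDomain 𝕜 𝕜 (Sigma.mk (k + 1)))
    (Finsupp.lmapDomain 𝕜 𝕜 (Sigma.mk k) ∘ₗ F.scalarDiff k) w fun j _ => ?_
  simp [totalDiff]

theorem totalDiff_single (F : MinimalFreeResolution I) (k : ℕ) (j : F.idx (k + 1)) :
    F.totalDiff (Finsupp.single ⟨k + 1, j⟩ 1) =
      Finsupp.mapDomain (Sigma.mk k) (F.scalarDiff k (Finsupp.single j 1)) := by
  rw [← totalDiff_succ, Finsupp.mapDomain_single]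

theorem mapDomain_sigmaMk_apply_ne_zero {α : ℕ → Type} {k : ℕ} {w : α k →₀ 𝕜}
    {l : Σ k, α k} (h : Finsupp.mapDomain (Sigma.mk k) w l ≠ 0) : ∃ i, l = ⟨k, i⟩ ∧ w i ≠ 0 := by
  classical
  have := Finsupp.mapDomain_support (Finsupp.mem_support_iff.2 h)
  simp only [Finset.mem_image, Finsupp.mem_support_iff] at this
  obtain ⟨i, hi, rfl⟩ := this
  exact ⟨i, rfl, hi⟩

/-- The dehomogenized resolution of `S / I`. -/
@[reducible] def toBasedComplex (F : MinimalFreeResolution I) : BasedComplex σ 𝕜 where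
  ι := Σ k, F.idx k
  hdeg x := x.1
  shift x := F.sh x.1 x.2
  d := F.totalDiff
  d_d w := by
    refine map_eq_of_single (F.totalDiff ∘ₗ F.totalDiff) 0 w fun x _ => ?_
    obtain ⟨k, j⟩ := x
    rw [LinearMap.comp_apply, LinearMap.zero_apply]
    match k with
    | 0 => rw [totalDiff_zero, map_zero]
    | 1 =>
      rw [totalDiff_single]
      refine map_eq_of_single (F.totalDiff ∘ₗ Finsupp.lmapDomain 𝕜 𝕜 (Sigma.mk 0)) 0 _ fun i _ => ?_
      simp [totalDiff_zero]
    | k + 2 =>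
      rw [totalDiff_single, totalDiff_succ, scalarDiff_scalarDiff, Finsupp.mapDomain_zero]
  d_single x l h := by
    obtain ⟨k, j⟩ := x
    cases k with
    | zero => simp [totalDiff_zero] at h
    | succ k =>
      rw [totalDiff_single] at h
      obtain ⟨i, rfl, hi⟩ := mapDomain_sigmaMk_apply_ne_zero h
      rw [scalarDiff_single] at hi
      exact ⟨rfl, le_of_component_ne_zero hi⟩
  base := ⟨0, ()⟩
  hdeg_eq_zero x := by
    obtain ⟨k, j⟩ := x
    constructor
    · rintro rfl; rfl
    · intro h; rw [h]

theorem exists_eq_mapDomain (F : MinimalFreeResolution I) {k : ℕ} {a : σ →₀ ℕ}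
    {z : (Σ k, F.idx k) →₀ 𝕜} (hz : z ∈ F.toBasedComplex.part k a) :
    ∃ w : F.idx k →₀ 𝕜, z = Finsupp.mapDomain (Sigma.mk k) w ∧ ∀ i, w i ≠ 0 → F.sh k i ≤ a := by
  rw [BasedComplex.mem_part] at hz
  refine ⟨Finsupp.comapDomain (Sigma.mk k) z sigma_mk_injective.injOn, ?_, fun i hi => ?_⟩
  · rw [Finsupp.mapDomain_comapDomain _ sigma_mk_injective]
    rintro ⟨k', i⟩ hi
    obtain rfl : k' = k := (hz ⟨k', i⟩ (by simpa using hi)).1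
    exact ⟨i, rfl⟩
  · exact (hz ⟨k, i⟩ hi).2

theorem mapDomain_mem_part (F : MinimalFreeResolution I) {k : ℕ} {a : σ →₀ ℕ}
    {w : F.idx k →₀ 𝕜} (hw : ∀ i, w i ≠ 0 → F.sh k i ≤ a) :
    Finsupp.mapDomain (Sigma.mk k) w ∈ F.toBasedComplex.part k a := by
  rw [BasedComplex.mem_part]
  intro l hl
  obtain ⟨i, rfl, hi⟩ := mapDomain_sigmaMk_apply_ne_zero hl
  exact ⟨rfl, hw i hi⟩

theorem toBasedComplex_acyclic (F : MinimalFreeResolution I) :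
    F.toBasedComplex.Acyclic {a | monomial a 1 ∈ I} := by
  classical
  intro a ha k z hz hdz
  obtain ⟨w, rfl, hw⟩ := F.exists_eq_mapDomain hz
  suffices H : ∃ u, F.diff k u = homogenize (F.sh k) a w by
    obtain ⟨u, hu⟩ := H
    refine ⟨Finsupp.mapDomain (Sigma.mk (k + 1)) (component (F.sh (k + 1)) a u),
      F.mapDomain_mem_part fun _ => le_of_component_ne_zero, ?_⟩
    change F.totalDiff _ = _
    rw [totalDiff_succ, ← component_diff, hu, component_homogenize hw, if_pos rfl]
  cases k with
  | zero =>
    obtain ⟨u, hu⟩ : monomial a 1 ∈ LinearMap.range F.aug := F.range_aug.ge ha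
    refine ⟨(C (w ()) : MvPolynomial σ 𝕜) • u, ?_⟩
    refine Finsupp.ext fun i => ?_
    rw [homogenize_apply]
    change Finsupp.single () (F.aug ((C (w ()) : MvPolynomial σ 𝕜) • u)) i =
      monomial (a - 0) (w ())
    rw [map_smul, hu, smul_eq_mul, C_mul_monomial, mul_one, tsub_zero]
    exact Finsupp.single_eq_same
  | succ k =>
    have h1 : F.scalarDiff k w = 0 := by
      have hdz : F.totalDiff _ = 0 := hdz
      rw [totalDiff_succ] at hdz
      exact Finsupp.mapDomain_injective sigma_mk_injective (by rw [hdz, Finsupp.mapDomain_zero])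
    refine (F.diff_exact k _).1 (eq_of_component_eq (s := F.sh k) fun b => ?_)
    rw [component_diff, component_homogenize hw, map_zero]
    split_ifs
    · exact h1
    · exact map_zero _

theorem isUpperSet_monomial_mem (I : Ideal (MvPolynomial σ 𝕜)) :
    IsUpperSet {a : σ →₀ ℕ | monomial a (1 : 𝕜) ∈ I} := by
  intro a b hab ha
  have : monomial b (1 : 𝕜) = monomial (b - a) 1 * monomial a 1 := by
    rw [monomial_mul, tsub_add_cancel_of_le hab, one_mul]
  change monomial b (1 : 𝕜) ∈ I
  rw [this]
  exact Ideal.mul_mem_left _ _ ha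

theorem sh_succ_mem (F : MinimalFreeResolution I) (k : ℕ) (j : F.idx (k + 1)) :
    monomial (F.sh (k + 1) j) (1 : 𝕜) ∈ I := by
  have hne : F.diff k (Finsupp.single j 1) ≠ 0 := fun h => by
    obtain ⟨w, hw⟩ := (F.diff_exact k _).1 h
    have := F.diff_minimal k w j
    rw [hw] at this
    simp at this
  induction k with
  | zero =>
    have hmem : F.aug (Finsupp.single j 1) ∈ I := F.range_aug.le ⟨_, rfl⟩
    have hne' : F.aug (Finsupp.single j 1) ≠ 0 := fun h => hne (by
      change Finsupp.single () (F.aug (Finsupp.single j 1)) = 0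
      rw [h, Finsupp.single_zero])
    have hmon : F.aug (Finsupp.single j 1) =
        monomial (F.shift 0 j) (coeff (F.shift 0 j) (F.aug (Finsupp.single j 1))) := by
      classical
      ext m
      rw [coeff_monomial]
      split_ifs with h
      · rw [h]
      · by_contra hm
        exact h (F.aug_homogeneous j m (mem_support_iff.2 hm)).symm
    set c := coeff (F.shift 0 j) (F.aug (Finsupp.single j 1))
    have hc : c ≠ 0 := fun h => hne' (by rw [hmon, h, map_zero])
    have h1 : monomial (F.shift 0 j) (1 : 𝕜) = C c⁻¹ * F.aug (Finsupp.single j 1) := by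
      rw [hmon, C_mul_monomial, inv_mul_cancel₀ hc]
    change monomial (F.shift 0 j) (1 : 𝕜) ∈ I
    rw [h1]
    exact Ideal.mul_mem_left _ _ hmem
  | succ k ih =>
    obtain ⟨l, hl⟩ := Finsupp.ne_iff.1 hne
    have hl : F.diff (k + 1) (Finsupp.single j 1) l ≠ 0 := by simpa using hl
    obtain ⟨m, hm⟩ := MvPolynomial.ne_zero_iff.1 hl
    have := F.diff_homogeneous (k + 1) j l m (mem_support_iff.2 hm)
    refine isUpperSet_monomial_mem I (by rw [← this]; exact le_add_self) (ih l fun h => ?_)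
    obtain ⟨w, hw⟩ := (F.diff_exact k _).1 h
    have := F.diff_minimal k w l
    rw [hw] at this
    simp at this

theorem toBasedComplex_isRes (F : MinimalFreeResolution I) (hI : I ≠ ⊤) :
    F.toBasedComplex.IsRes 0 {a | monomial a 1 ∈ I} where
  shift_base := rfl
  shift_mem := by
    rintro ⟨k, j⟩ hj
    cases k with
    | zero => exact (hj rfl).elim
    | succ k => exact F.sh_succ_mem k j
  acyclic := F.toBasedComplex_acyclic
  minimal := by
    rintro ⟨k, j⟩ l h
    cases k with
    | zero => exact (h (by rw [F.totalDiff_zero]; rfl)).elim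
    | succ k =>
      have h : F.totalDiff (Finsupp.single ⟨k + 1, j⟩ 1) l ≠ 0 := h
      rw [F.totalDiff_single] at h
      obtain ⟨i, rfl, hi⟩ := mapDomain_sigmaMk_apply_ne_zero h
      rw [F.scalarDiff_single] at hi
      intro e
      have e : F.sh k i = F.sh (k + 1) j := e
      cases k with
      | zero =>
        -- An entry `1` of the augmentation would put `1` into `I`.
        refine hI ((Ideal.eq_top_iff_one I).2 ?_)
        have := F.sh_succ_mem 0 j
        rwa [← e] at this
      | succ k =>
        rw [component_apply, if_pos e.le, e, tsub_self, F.diff_minimal] at hi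
        exact hi rfl

end MinimalFreeResolution

end

/-! ### From based complexes to minimal free resolutions -/

noncomputable section

open MvPolynomial

namespace BasedComplex

variable {σ 𝕜 : Type*} [Field 𝕜]

/-- The differential over the polynomial ring. -/
def polyD (C : BasedComplex σ 𝕜) :
    (C.ι →₀ MvPolynomial σ 𝕜) →ₗ[MvPolynomial σ 𝕜] (C.ι →₀ MvPolynomial σ 𝕜) :=
  Finsupp.lsum (MvPolynomial σ 𝕜) fun j => LinearMap.toSpanSingleton (MvPolynomial σ 𝕜) _
    (homogenize C.shift (C.shift j) (C.d (Finsupp.single j 1)))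

theorem polyD_single (C : BasedComplex σ 𝕜) (j : C.ι) : C.polyD (Finsupp.single j 1) =
    homogenize C.shift (C.shift j) (C.d (Finsupp.single j 1)) := by
  simp [polyD]

theorem polyD_homogeneous (C : BasedComplex σ 𝕜) (j : C.ι) :
    IsMultihomogeneous C.shift (C.shift j) (C.polyD (Finsupp.single j 1)) := by
  rw [polyD_single]
  exact isMultihomogeneous_homogenize fun l hl => (C.d_single j l hl).2

theorem component_polyD (C : BasedComplex σ 𝕜) (a : σ →₀ ℕ) (v : C.ι →₀ MvPolynomial σ 𝕜) :
    component C.shift a (C.polyD v) = C.d (component C.shift a v) := by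
  rw [component_map C.polyD_homogeneous]
  refine map_eq_of_single _ _ _ fun j _ => ?_
  rw [dehomogenize_single, polyD_single,
    component_homogenize fun l hl => (C.d_single j l hl).2, if_pos rfl, one_smul]

theorem polyD_polyD (C : BasedComplex σ 𝕜) (v : C.ι →₀ MvPolynomial σ 𝕜) :
    C.polyD (C.polyD v) = 0 :=
  eq_of_component_eq (s := C.shift) fun a => by
    rw [component_polyD, component_polyD, C.d_d, map_zero]

/-- All terms of `v` lie in homological degree `k`. -/
def HasDeg (C : BasedComplex σ 𝕜) (k : ℕ) (v : C.ι →₀ MvPolynomial σ 𝕜) : Prop :=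
  ∀ j, v j ≠ 0 → C.hdeg j = k

theorem HasDeg.component_mem_part {C : BasedComplex σ 𝕜} {k : ℕ} {v : C.ι →₀ MvPolynomial σ 𝕜}
    (hv : C.HasDeg k v) (a : σ →₀ ℕ) : component C.shift a v ∈ C.part k a := by
  rw [mem_part]
  intro j hj
  refine ⟨hv j fun h => hj ?_, le_of_component_ne_zero hj⟩
  rw [component_apply, h]
  simp

theorem HasDeg.polyD {C : BasedComplex σ 𝕜} {k : ℕ} {v : C.ι →₀ MvPolynomial σ 𝕜}
    (hv : C.HasDeg (k + 1) v) : C.HasDeg k (C.polyD v) := by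
  intro j hj
  obtain ⟨m, hm⟩ := MvPolynomial.ne_zero_iff.1 hj
  have h1 : component C.shift (m + C.shift j) (C.polyD v) j ≠ 0 := by
    simpa [component_apply] using hm
  rw [component_polyD] at h1
  exact (mem_part.1 (C.d_mem_part (hv.component_mem_part _)) j h1).1

/-- A vector all of whose components are boundaries is a boundary. -/
theorem exists_polyD_eq (C : BasedComplex σ 𝕜) {k : ℕ} {v : C.ι →₀ MvPolynomial σ 𝕜}
    (h : ∀ a, ∃ w ∈ C.part (k + 1) a, C.d w = component C.shift a v) :
    ∃ w, C.HasDeg (k + 1) w ∧ C.polyD w = v := by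
  classical
  choose w hw hdw using h
  set s : Finset (σ →₀ ℕ) := v.support.biUnion fun j =>
    (v j).support.image fun m => m + C.shift j with hs
  have hv : ∀ a, a ∉ s → component C.shift a v = 0 := fun a ha => by
    ext j
    by_contra h
    have hle := le_of_component_ne_zero h
    rw [component_apply, if_pos hle] at h
    refine ha (Finset.mem_biUnion.2 ⟨j, ?_, Finset.mem_image.2 ⟨_, mem_support_iff.2 h,
      tsub_add_cancel_of_le hle⟩⟩)
    rw [Finsupp.mem_support_iff]
    rintro e
    simp [e] at h
  have hwle : ∀ a l, w a l ≠ 0 → C.shift l ≤ a := fun a l hl => (mem_part.1 (hw a) l hl).2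
  refine ⟨∑ a ∈ s, homogenize C.shift a (w a), fun j hj => ?_,
    eq_of_component_eq (s := C.shift) fun b => ?_⟩
  · rw [Finsupp.finsetSum_apply] at hj
    obtain ⟨a, -, ha⟩ := Finset.exists_ne_zero_of_sum_ne_zero hj
    rw [homogenize_apply] at ha
    exact (mem_part.1 (hw a) j fun h => ha (by rw [h, map_zero])).1
  · rw [component_polyD, map_sum]
    simp_rw [component_homogenize (hwle _)]
    rw [Finset.sum_ite_eq' s b w]
    split_ifs with hb
    · exact hdw b
    · rw [map_zero, hv b hb]

theorem IsRes.exists_polyD_eq {C : BasedComplex σ 𝕜} {U : Set (σ →₀ ℕ)} (hC : C.IsRes 0 U)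
    (hU : IsUpperSet U) {k : ℕ} {v : C.ι →₀ MvPolynomial σ 𝕜} (hv : C.HasDeg (k + 1) v)
    (hdv : C.polyD v = 0) : ∃ w, C.HasDeg (k + 2) w ∧ C.polyD w = v := by
  refine C.exists_polyD_eq fun a => ?_
  by_cases ha : a ∈ U
  · exact hC.acyclic a ha _ _ (hv.component_mem_part a) (by rw [← component_polyD, hdv, map_zero])
  · exact ⟨0, zero_mem _, by rw [hC.part_eq_zero hU ha (hv.component_mem_part a), map_zero]⟩

/-- The vectors of the part of homological degree `k + 1` as vectors of the whole complex. -/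
def inc (C : BasedComplex σ 𝕜) (k : ℕ) : ({j // C.hdeg j = k + 1} →₀ MvPolynomial σ 𝕜)
    →ₗ[MvPolynomial σ 𝕜] (C.ι →₀ MvPolynomial σ 𝕜) :=
  Finsupp.lmapDomain _ _ Subtype.val

/-- The projection to the part of homological degree `k + 1`. -/
def res (C : BasedComplex σ 𝕜) (k : ℕ) : (C.ι →₀ MvPolynomial σ 𝕜) →ₗ[MvPolynomial σ 𝕜]
    ({j // C.hdeg j = k + 1} →₀ MvPolynomial σ 𝕜) :=
  Finsupp.lcomapDomain Subtype.val Subtype.val_injective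

theorem res_apply (C : BasedComplex σ 𝕜) (k : ℕ) (v : C.ι →₀ MvPolynomial σ 𝕜)
    (j : {j // C.hdeg j = k + 1}) : C.res k v j = v j.1 := rfl

theorem inc_single (C : BasedComplex σ 𝕜) (k : ℕ) (j : {j // C.hdeg j = k + 1})
    (p : MvPolynomial σ 𝕜) : C.inc k (Finsupp.single j p) = Finsupp.single j.1 p :=
  Finsupp.mapDomain_single

theorem hasDeg_inc (C : BasedComplex σ 𝕜) (k : ℕ)
    (v : {j // C.hdeg j = k + 1} →₀ MvPolynomial σ 𝕜) : C.HasDeg (k + 1) (C.inc k v) := by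
  classical
  intro j hj
  have := Finsupp.mapDomain_support (Finsupp.mem_support_iff.2 hj)
  obtain ⟨i, -, rfl⟩ := Finset.mem_image.1 this
  exact i.2

theorem res_inc (C : BasedComplex σ 𝕜) (k : ℕ)
    (v : {j // C.hdeg j = k + 1} →₀ MvPolynomial σ 𝕜) : C.res k (C.inc k v) = v :=
  Finsupp.comapDomain_mapDomain _ Subtype.val_injective v

theorem inc_res (C : BasedComplex σ 𝕜) {k : ℕ} {v : C.ι →₀ MvPolynomial σ 𝕜}
    (hv : C.HasDeg (k + 1) v) : C.inc k (C.res k v) = v := by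
  refine Finsupp.mapDomain_comapDomain _ Subtype.val_injective v fun j hj => ?_
  exact ⟨⟨j, hv j (by simpa using hj)⟩, rfl⟩

theorem mem_smul_top {ι : Type*} {J : Ideal (MvPolynomial σ 𝕜)} {v : ι →₀ MvPolynomial σ 𝕜}
    (h : ∀ l, v l ∈ J) :
    v ∈ J • (⊤ : Submodule (MvPolynomial σ 𝕜) (ι →₀ MvPolynomial σ 𝕜)) := by
  rw [← Finsupp.sum_single v]
  refine Submodule.sum_mem _ fun l _ => ?_
  have : Finsupp.single l (v l) = v l • Finsupp.single l 1 := by simp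
  rw [this]
  exact Submodule.smul_mem_smul (h l) trivial

/-- The minimal free resolution obtained from a based complex that resolves `S / I`. -/
def toResolution (C : BasedComplex σ 𝕜) [Finite C.ι] {U : Set (σ →₀ ℕ)} (hC : C.IsRes 0 U)
    (hU : IsUpperSet U) (I : Ideal (MvPolynomial σ 𝕜))
    (hI : ∀ f, f ∈ I ↔ ∀ m ∈ f.support, m ∈ U) : MinimalFreeResolution I where
  ι k := {j // C.hdeg j = k + 1}
  finite _ := inferInstance
  shift _ j := C.shift j.1
  aug := Finsupp.lapply C.base ∘ₗ C.polyD ∘ₗ C.inc 0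
  d k := C.res k ∘ₗ C.polyD ∘ₗ C.inc (k + 1)
  aug_homogeneous j m hm := by
    simp only [LinearMap.comp_apply, inc_single, Finsupp.lapply_apply] at hm
    have := C.polyD_homogeneous j.1 C.base m hm
    rwa [hC.shift_base, add_zero] at this
  d_homogeneous k j l m hm := by
    simp only [LinearMap.comp_apply, inc_single, res_apply] at hm
    exact C.polyD_homogeneous j.1 l.1 m hm
  range_aug := by
    ext f
    rw [LinearMap.mem_range, hI]
    constructor
    · rintro ⟨v, rfl⟩ m hm
      simp only [LinearMap.comp_apply, Finsupp.lapply_apply] at hm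
      have h1 : component C.shift m (C.polyD (C.inc 0 v)) C.base ≠ 0 := by
        rw [component_apply, hC.shift_base, if_pos zero_le, tsub_zero]
        exact mem_support_iff.1 hm
      rw [component_polyD] at h1
      obtain ⟨l, hl, -⟩ := exists_apply_single_ne_zero _ h1
      have h2 := mem_part.1 ((C.hasDeg_inc 0 v).component_mem_part m) l hl
      refine hU h2.2 (hC.shift_mem l ?_)
      rintro rfl
      simp at h2
    · intro hf
      obtain ⟨w, hw, hdw⟩ := C.exists_polyD_eq (k := 0) (v := Finsupp.single C.base f) fun a => by
        have hdeg : C.HasDeg 0 (Finsupp.single C.base f) := fun j hj => by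
          have : j = C.base := by by_contra h; simp [h] at hj
          rw [this, hdeg_base]
        have hp := hdeg.component_mem_part a
        by_cases ha : a ∈ U
        · exact hC.acyclic a ha _ _ hp (C.d_eq_zero_of_mem_part hp)
        · refine ⟨0, zero_mem _, ?_⟩
          have : coeff a f = 0 := by
            by_contra h
            exact ha (hf a (mem_support_iff.2 h))
          rw [eq_single_base hp, component_apply, hC.shift_base]
          simp [this]
      refine ⟨C.res 0 w, ?_⟩
      simp [inc_res C hw, hdw]
  exact_aug := by
    ext v
    rw [LinearMap.mem_range, LinearMap.mem_ker]
    constructor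
    · rintro ⟨w, rfl⟩
      simp [inc_res C (C.hasDeg_inc 1 w).polyD, polyD_polyD]
    · intro hv
      simp only [LinearMap.comp_apply, Finsupp.lapply_apply] at hv
      have h0 : C.polyD (C.inc 0 v) = 0 := by
        ext1 j
        by_cases hj : j = C.base
        · rw [hj, hv, Finsupp.zero_apply]
        · by_contra h
          exact hj ((C.hdeg_eq_zero j).1 ((C.hasDeg_inc 0 v).polyD j h))
      obtain ⟨w, hw, hdw⟩ := hC.exists_polyD_eq hU (C.hasDeg_inc 0 v) h0
      refine ⟨C.res 1 w, ?_⟩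
      simp only [LinearMap.comp_apply]
      rw [inc_res C hw, hdw, res_inc]
  exact k := by
    ext v
    rw [LinearMap.mem_range, LinearMap.mem_ker]
    constructor
    · rintro ⟨w, rfl⟩
      simp [inc_res C (C.hasDeg_inc (k + 2) w).polyD, polyD_polyD]
    · intro hv
      simp only [LinearMap.comp_apply] at hv
      have h0 : C.polyD (C.inc (k + 1) v) = 0 := by
        rw [← inc_res C (C.hasDeg_inc (k + 1) v).polyD, hv, map_zero]
      obtain ⟨w, hw, hdw⟩ := hC.exists_polyD_eq hU (C.hasDeg_inc (k + 1) v) h0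
      refine ⟨C.res (k + 2) w, ?_⟩
      simp only [LinearMap.comp_apply]
      rw [inc_res C hw, hdw, res_inc]
  minimal k := by
    classical
    rintro _ ⟨v, rfl⟩
    induction v using Finsupp.induction_linear with
    | zero => rw [map_zero]; exact zero_mem _
    | add f g hf hg => rw [map_add]; exact add_mem hf hg
    | single j p =>
      have : Finsupp.single j p = p • Finsupp.single j 1 := by simp
      rw [this, map_smul]
      refine Submodule.smul_mem _ _ (mem_smul_top fun l => ?_)
      simp only [LinearMap.comp_apply, inc_single, res_apply]
      rw [polyD_single, homogenize_apply, ← Set.image_univ, mem_ideal_span_X_image]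
      intro m hm
      rw [mem_support_iff, coeff_monomial] at hm
      by_cases e : C.shift j.1 - C.shift l.1 = m
      · rw [if_pos e] at hm
        have hle := (C.d_single j.1 l.1 hm).2
        by_contra! hcon
        refine hC.minimal j.1 l.1 hm ?_
        have hm0 : m = 0 := by ext i; simpa using hcon i trivial
        rw [hm0, tsub_eq_zero_iff_le] at e
        exact le_antisymm hle e
      · rw [if_neg e] at hm
        exact (hm rfl).elim

end BasedComplex

/-- The homological shift ideals can be read off from any based complex that resolves `S / I`. -/
theorem HS_eq_span {σ 𝕜 : Type*} [Field 𝕜] {I : Ideal (MvPolynomial σ 𝕜)} {U : Set (σ →₀ ℕ)}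
    {D : ℕ → Set (σ →₀ ℕ)} (h : HasRes 𝕜 0 U D) (hU : IsUpperSet U)
    (hI : ∀ f, f ∈ I ↔ ∀ m ∈ f.support, m ∈ U) (hI' : I ≠ ⊤) (k : ℕ) :
    HS k I = Ideal.span ((fun a => monomial a (1 : 𝕜)) '' D (k + 1)) := by
  classical
  obtain ⟨C, hfin, hC, hD⟩ := h
  have hUI : {a | monomial a (1 : 𝕜) ∈ I} = U := by
    ext a
    rw [Set.mem_ofPred_eq, hI, support_monomial, if_neg one_ne_zero]
    simp
  unfold HS
  congr 1
  ext f
  simp only [Set.mem_ofPred_eq, Set.mem_image, ← hD]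
  constructor
  · rintro ⟨F, j, rfl⟩
    have hF := F.toBasedComplex_isRes hI'
    rw [hUI] at hF
    obtain ⟨l, h1, h2⟩ := BasedComplex.exists_shift_eq F.toBasedComplex C hF.acyclic hC.acyclic
      hF.shift_mem hC.shift_mem (hC.shift_base.trans hF.shift_base.symm) hF.minimal ⟨k + 1, j⟩
    exact ⟨F.shift k j, ⟨l, h1, h2⟩, rfl⟩
  · rintro ⟨a, ⟨j, h1, rfl⟩, rfl⟩
    exact ⟨C.toResolution hC hU I hI, ⟨j, h1⟩, rfl⟩

end

/-! ### Linear quotients of squarefree monomial ideals generated in one degree -/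

noncomputable section

open MvPolynomial

section LinearQuotients

variable {V : Type*} (𝕜 : Type*) [Field 𝕜]

/-- The squarefree monomial ideal generated by the products of the members of `𝒲`. -/
def setIdeal (𝒲 : Set (Finset V)) : Ideal (MvPolynomial V 𝕜) :=
  Ideal.span ((fun a => monomial a (1 : 𝕜)) '' (ind '' 𝒲))

variable {𝕜}

theorem ind_le_iff {W : Finset V} {b : V →₀ ℕ} : ind W ≤ b ↔ ∀ v ∈ W, b v ≠ 0 := by
  classical
  constructor
  · intro h v hv
    have := h v
    rw [ind_apply, if_pos hv] at this
    omega
  · intro h v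
    rw [ind_apply]
    split_ifs with hv
    · have := h v hv; omega
    · exact Nat.zero_le _

theorem ind_le_ind {W W' : Finset V} : ind W ≤ ind W' ↔ W ⊆ W' := by
  classical
  rw [ind_le_iff]
  exact forall₂_congr fun v _ => by rw [ind_apply]; simp

theorem ind_injective : Function.Injective (ind : Finset V → V →₀ ℕ) := fun _ _ h =>
  Finset.Subset.antisymm (ind_le_ind.1 h.le) (ind_le_ind.1 h.ge)

theorem mem_span_monomial {S : Set (V →₀ ℕ)} {b : V →₀ ℕ} :
    monomial b (1 : 𝕜) ∈ Ideal.span ((fun a => monomial a (1 : 𝕜)) '' S) ↔ ∃ a ∈ S, a ≤ b := by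
  classical
  rw [mem_ideal_span_monomial_image, support_monomial, if_neg one_ne_zero]
  simp

theorem minGens_setIdeal {𝒲 : Set (Finset V)} {d : ℕ} (hd : ∀ W ∈ 𝒲, W.card = d) :
    minGens (setIdeal 𝕜 𝒲) = ind '' 𝒲 := by
  ext b
  simp only [minGens, setIdeal, Set.mem_ofPred_eq, mem_span_monomial]
  constructor
  · rintro ⟨⟨_, ⟨W, hW, rfl⟩, hWb⟩, hmin⟩
    exact ⟨W, hW, le_antisymm hWb (hmin ⟨_, ⟨W, hW, rfl⟩, le_rfl⟩ hWb)⟩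
  · rintro ⟨W, hW, rfl⟩
    refine ⟨⟨_, ⟨W, hW, rfl⟩, le_rfl⟩, ?_⟩
    rintro c ⟨_, ⟨W', hW', rfl⟩, hc⟩ hcW
    have := Finset.eq_of_subset_of_card_le (ind_le_ind.1 (hc.trans hcW))
      (by rw [hd W hW, hd W' hW'])
    exact this ▸ hc

theorem mem_colon_monomial {S : Set (V →₀ ℕ)} {b : V →₀ ℕ} {g : MvPolynomial V 𝕜} :
    g ∈ (Ideal.span ((fun a => monomial a (1 : 𝕜)) '' S)).colon {monomial b (1 : 𝕜)} ↔
      ∀ c ∈ g.support, ∃ a ∈ S, a ≤ c + b := by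
  classical
  rw [Submodule.mem_colon_singleton, smul_eq_mul, mem_ideal_span_monomial_image]
  constructor
  · intro h c hc
    refine h (c + b) ?_
    rw [mem_support_iff, coeff_mul_monomial, mul_one]
    exact mem_support_iff.1 hc
  · intro h c hc
    rw [mem_support_iff, coeff_mul_monomial', mul_one] at hc
    by_cases hbc : b ≤ c
    · rw [if_pos hbc] at hc
      obtain ⟨a, ha, hab⟩ := h _ (mem_support_iff.2 hc)
      exact ⟨a, ha, by rwa [tsub_add_cancel_of_le hbc] at hab⟩
    · simp [hbc] at hc

/-- An exchange property that produces linear quotients for the order given by `f`. -/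
theorem hasLinearQuotients_of_exchange [DecidableEq V] {α : Type*} [LinearOrder α]
    {𝒲 : Set (Finset V)} (hfin : 𝒲.Finite) {d : ℕ} (hd : ∀ W ∈ 𝒲, W.card = d)
    (f : Finset V → α) (hf : Function.Injective f)
    (h : ∀ W ∈ 𝒲, ∀ W' ∈ 𝒲, f W' < f W →
      ∃ W'' ∈ 𝒲, f W'' < f W ∧ ∃ v ∈ W' \ W, W'' ⊆ insert v W) :
    HasLinearQuotients (setIdeal 𝕜 𝒲) := by
  set T : Finset α := hfin.toFinset.map ⟨f, hf⟩ with hT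
  have hmem : ∀ i, ∃ W ∈ 𝒲, f W = T.orderEmbOfFin rfl i := fun i => by
    obtain ⟨W, hW, e⟩ := Finset.mem_map.1 (T.orderEmbOfFin_mem rfl i)
    exact ⟨W, hfin.mem_toFinset.1 hW, e⟩
  choose e he hfe using hmem
  have hlt : ∀ i j, f (e i) < f (e j) ↔ i < j := fun i j => by
    rw [hfe, hfe, OrderEmbedding.lt_iff_lt]
  have hsurj : ∀ W ∈ 𝒲, ∃ i, e i = W := fun W hW => by
    have : f W ∈ Set.range (T.orderEmbOfFin rfl) := by
      rw [Finset.range_orderEmbOfFin, hT]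
      simpa using ⟨W, hW, rfl⟩
    obtain ⟨i, hi⟩ := this
    exact ⟨i, hf ((hfe i).trans hi)⟩
  refine ⟨T.card, fun i => ind (e i), fun i j hij => ?_, ?_, fun i _ => ?_⟩
  · have := congrArg f (ind_injective hij)
    rw [hfe, hfe] at this
    exact (T.orderEmbOfFin rfl).injective this
  · rw [minGens_setIdeal hd]
    ext b
    constructor
    · rintro ⟨i, rfl⟩; exact ⟨_, he i, rfl⟩
    · rintro ⟨W, hW, rfl⟩
      obtain ⟨i, rfl⟩ := hsurj W hW
      exact ⟨i, rfl⟩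
  · refine ⟨{v | ∃ t < i, e t ⊆ insert v (e i)}, ?_⟩
    have himg : (fun t => monomial (ind (e t)) (1 : 𝕜)) '' Set.Iio i =
        (fun a => monomial a (1 : 𝕜)) '' ((fun t => ind (e t)) '' Set.Iio i) := by
      rw [Set.image_image]
    ext g
    rw [himg, mem_colon_monomial, mem_ideal_span_X_image]
    refine forall₂_congr fun c _ => ?_
    constructor
    · rintro ⟨_, ⟨t, ht, rfl⟩, hle⟩
      obtain ⟨W'', hW'', hlt'', v, hv, hsub⟩ := h _ (he i) _ (he t) ((hlt t i).2 ht)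
      obtain ⟨s, rfl⟩ := hsurj W'' hW''
      refine ⟨v, ⟨s, (hlt s i).1 hlt'', hsub⟩, fun hc => ?_⟩
      rw [Finset.mem_sdiff] at hv
      have := ind_le_iff.1 hle v hv.1
      rw [Finsupp.add_apply, hc, ind_apply, if_neg hv.2] at this
      exact this rfl
    · rintro ⟨v, ⟨t, ht, hsub⟩, hv⟩
      refine ⟨_, ⟨t, ht, rfl⟩, ind_le_iff.2 fun u hu => ?_⟩
      rw [Finsupp.add_apply, ind_apply]
      rcases Finset.mem_insert.1 (hsub hu) with rfl | h'
      · omega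
      · rw [if_pos h']; omega

/-- In an ideal with linear quotients that is generated in one degree, the later of two generators
`W₁`, `W₂` can be moved towards the earlier one by exchanging a single variable. -/
theorem not_hasLinearQuotients_of_isolated [DecidableEq V] {𝒲 : Set (Finset V)} {d : ℕ}
    (hd : ∀ W ∈ 𝒲, W.card = d) {W₁ W₂ : Finset V} (h₁ : W₁ ∈ 𝒲) (h₂ : W₂ ∈ 𝒲)
    (h : ∀ W ∈ 𝒲, W ⊆ W₁ ∪ W₂ → W = W₁ ∨ W = W₂) (hcard : 1 < (W₁ \ W₂).card) :
    ¬ HasLinearQuotients (setIdeal 𝕜 𝒲) := by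
  classical
  rintro ⟨q, m, hinj, hrange, hlin⟩
  rw [minGens_setIdeal hd] at hrange
  obtain ⟨i₁, hi₁⟩ : ind W₁ ∈ Set.range m := hrange ▸ ⟨_, h₁, rfl⟩
  obtain ⟨i₂, hi₂⟩ : ind W₂ ∈ Set.range m := hrange ▸ ⟨_, h₂, rfl⟩
  have key : ∀ (W W' : Finset V) (i i' : Fin q), m i = ind W → m i' = ind W' → i < i' →
      (∀ W'' ∈ 𝒲, W'' ⊆ W ∪ W' → W'' = W ∨ W'' = W') → ∃ v, W ⊆ insert v W' := by
    intro W W' i i' hi hi' hlt hW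
    obtain ⟨A, hA⟩ := hlin i' (lt_of_le_of_lt (Nat.zero_le _) hlt)
    have himg : (fun t => monomial (m t) (1 : 𝕜)) '' Set.Iio i' =
        (fun a => monomial a (1 : 𝕜)) '' (m '' Set.Iio i') := by
      rw [Set.image_image]
    have hmem : monomial (ind W - ind W') (1 : 𝕜) ∈
        Ideal.span ((X : V → MvPolynomial V 𝕜) '' A) := by
      rw [← hA, himg, mem_colon_monomial]
      intro c hc
      rw [support_monomial, if_neg one_ne_zero, Finset.mem_singleton] at hc
      exact ⟨_, ⟨i, hlt, rfl⟩, by rw [hc, hi, hi']; exact le_tsub_add⟩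
    rw [mem_ideal_span_X_image] at hmem
    obtain ⟨v, hvA, hv⟩ := hmem (ind W - ind W') (by
      rw [support_monomial, if_neg one_ne_zero]; exact Finset.mem_singleton_self _)
    have hX : (X v : MvPolynomial V 𝕜) ∈ Ideal.span ((X : V → MvPolynomial V 𝕜) '' A) :=
      Ideal.subset_span ⟨v, hvA, rfl⟩
    rw [← hA, himg, mem_colon_monomial] at hX
    obtain ⟨_, ⟨t, ht, rfl⟩, hle⟩ := hX (Finsupp.single v 1) (by
      rw [support_X]; exact Finset.mem_singleton_self _)
    obtain ⟨W'', hW'', e⟩ : m t ∈ ind '' 𝒲 := hrange ▸ ⟨t, rfl⟩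
    have hsub : W'' ⊆ insert v W' := by
      rw [← e, hi', ind_le_iff] at hle
      intro u hu
      have := hle u hu
      rw [Finsupp.add_apply, ind_apply] at this
      by_contra hcon
      rw [Finset.mem_insert, not_or] at hcon
      rw [if_neg hcon.2, Finsupp.single_apply, if_neg (Ne.symm hcon.1)] at this
      exact this rfl
    have hvW : v ∈ W := by
      by_contra hcon
      rw [Finsupp.tsub_apply, ind_apply, if_neg hcon] at hv
      simp at hv
    rcases hW W'' hW'' (hsub.trans (Finset.insert_subset (Finset.mem_union_left _ hvW)
      Finset.subset_union_right)) with rfl | rfl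
    · exact ⟨v, hsub⟩
    · have : t = i' := hinj (e.symm.trans hi'.symm)
      exact absurd ht (by simp [this])
  have hdist : ∀ W W' : Finset V, 1 < (W \ W').card → ¬ ∃ v, W ⊆ insert v W' := by
    rintro W W' hlt ⟨v, hv⟩
    have : W \ W' ⊆ {v} := fun u hu => by
      rw [Finset.mem_sdiff] at hu
      exact Finset.mem_singleton.2 ((Finset.mem_insert.1 (hv hu.1)).resolve_right hu.2)
    exact absurd (Finset.card_le_card this) (by rw [Finset.card_singleton]; omega)
  rcases lt_trichotomy i₁ i₂ with hlt | heq | hlt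
  · exact hdist _ _ hcard (key W₁ W₂ i₁ i₂ hi₁ hi₂ hlt h)
  · have : W₁ = W₂ := ind_injective (by rw [← hi₁, ← hi₂, heq])
    simp [this] at hcard
  · refine hdist W₂ W₁ ?_ (key W₂ W₁ i₂ i₁ hi₂ hi₁ hlt fun W hW hs =>
      (h W hW (Finset.union_comm W₂ W₁ ▸ hs)).symm)
    rwa [Finset.card_sdiff_comm ((hd _ h₂).trans (hd _ h₁).symm)]

end LinearQuotients

end

/-! ### Edge ideals with linear quotients -/

noncomputable section

open MvPolynomial

section EdgeIdeal

variable {V : Type*}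

/-- The variables generating the colon ideal of the edge `i j`, for the lexicographic order of the
edges by the ranks of the larger and of the smaller end. -/
def colonVars (G : SimpleGraph V) (ρ : V → ℕ) (i j : V) : Set V :=
  {u | u ≠ i ∧ u ≠ j ∧ (G.Adj u j ∧ ρ u < ρ i ∨ G.Adj u i ∧ ρ u < ρ j)}

/-- The lexicographic order of the edges by the ranks of the larger and of the smaller end gives
linear quotients: every earlier edge contains one of the colon variables. -/
def LexLinear (G : SimpleGraph V) (ρ : V → ℕ) : Prop :=
  ∀ i j a b, G.Adj i j → ρ i < ρ j → G.Adj a b → ρ a < ρ b →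
    (ρ b < ρ j ∨ ρ b = ρ j ∧ ρ a < ρ i) → a ∈ colonVars G ρ i j ∨ b ∈ colonVars G ρ i j

/-- The supports of the multidegrees of the `k`-th free module in the resolution of the edge
ideal. -/
def shiftSets (G : SimpleGraph V) (ρ : V → ℕ) (k : ℕ) : Set (Finset V) :=
  {W | W.card = k + 2 ∧ ∃ i ∈ W, ∃ j ∈ W, G.Adj i j ∧ ρ i < ρ j ∧
    ∀ u ∈ W, u = i ∨ u = j ∨ u ∈ colonVars G ρ i j}

theorem single_add_single_le {u v : V} (huv : u ≠ v) {m : V →₀ ℕ} :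
    Finsupp.single u 1 + Finsupp.single v 1 ≤ m ↔ m u ≠ 0 ∧ m v ≠ 0 := by
  classical
  have : (Finsupp.single u 1 + Finsupp.single v 1 : V →₀ ℕ) = ind {u, v} := by
    rw [ind, Finset.sum_pair huv]
  rw [this, ind_le_iff]
  simp

/-- The exponents of the monomials in the edge ideal. -/
def edgeExponents (G : SimpleGraph V) : Set (V →₀ ℕ) :=
  {m | ∃ u v, G.Adj u v ∧ Finsupp.single u 1 + Finsupp.single v 1 ≤ m}

theorem mem_edgeIdeal {𝕜 : Type*} [Field 𝕜] {G : SimpleGraph V} {f : MvPolynomial V 𝕜} :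
    f ∈ edgeIdeal 𝕜 G ↔ ∀ m ∈ f.support, m ∈ edgeExponents G := by
  have : edgeIdeal 𝕜 G = Ideal.span ((fun a => monomial a (1 : 𝕜)) ''
      {a | ∃ u v, G.Adj u v ∧ a = Finsupp.single u 1 + Finsupp.single v 1}) := by
    unfold edgeIdeal
    congr 1
    ext f
    constructor
    · rintro ⟨u, v, h, rfl⟩
      exact ⟨_, ⟨u, v, h, rfl⟩, by simp [X, monomial_mul]⟩
    · rintro ⟨_, ⟨u, v, h, rfl⟩, rfl⟩
      exact ⟨u, v, h, by simp [X, monomial_mul]⟩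
  rw [this, mem_ideal_span_monomial_image]
  refine forall₂_congr fun m _ => ?_
  constructor
  · rintro ⟨_, ⟨u, v, h, rfl⟩, hm⟩
    exact ⟨u, v, h, hm⟩
  · rintro ⟨u, v, h, hm⟩
    exact ⟨_, ⟨u, v, h, rfl⟩, hm⟩

theorem hasRes_edgeExponents {𝕜 : Type*} [Field 𝕜] [Finite V] {G : SimpleGraph V} {ρ : V → ℕ}
    (hρ : Function.Injective ρ) (hG : LexLinear G ρ) :
    ∃ D : ℕ → Set (V →₀ ℕ), HasRes 𝕜 0 (edgeExponents G) D ∧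
      ∀ k, D (k + 1) = ind '' shiftSets G ρ k := by
  classical
  cases nonempty_fintype V
  have h := hasRes_of_linearQuotients (𝕜 := 𝕜) (σ := V) (ε := V × V) (α := ℕ ×ₗ ℕ)
    (fun e => toLex (ρ e.2, ρ e.1))
    (fun e e' he => by
      have := toLex.injective he
      rw [Prod.mk.injEq] at this
      exact Prod.ext (hρ this.2) (hρ this.1))
    (Finset.univ.filter fun e => G.Adj e.1 e.2 ∧ ρ e.1 < ρ e.2)
    (fun e => Finsupp.single e.1 1 + Finsupp.single e.2 1)
    (fun e => Finset.univ.filter fun u => u ∈ colonVars G ρ e.1 e.2)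
    (fun e _ => by simp) ?_
  · refine ⟨_, h.congr ?_ fun k a => Iff.rfl, fun k => ?_⟩
    · ext m
      simp only [Set.mem_ofPred_eq, Finset.mem_filter, Finset.mem_univ, true_and, Prod.exists,
        edgeExponents]
      constructor
      · rintro ⟨u, v, ⟨h1, -⟩, h2⟩
        exact ⟨u, v, h1, h2⟩
      · rintro ⟨u, v, h1, h2⟩
        rcases lt_or_gt_of_ne (hρ.ne h1.ne) with hlt | hlt
        · exact ⟨u, v, ⟨h1, hlt⟩, h2⟩
        · exact ⟨v, u, ⟨h1.symm, hlt⟩, by rwa [add_comm]⟩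
    · ext a
      simp only [Set.mem_ofPred_eq, Finset.mem_filter, Finset.mem_univ, true_and, Prod.exists,
        Set.mem_image, shiftSets, Nat.add_eq_zero_iff, one_ne_zero, and_false, false_and, false_or]
      have hins : ∀ (i j : V) (B : Finset V), i ≠ j → i ∉ B → j ∉ B →
          ind (insert i (insert j B)) = Finsupp.single i 1 + Finsupp.single j 1 + ind B := by
        intro i j B hij hi hj
        rw [ind_insert (by simp [hij, hi]), ind_insert hj, add_assoc]
      constructor
      · rintro ⟨i, j, ⟨hadj, hlt⟩, B, hB, hcard, rfl⟩
        have hB : ∀ u ∈ B, u ∈ colonVars G ρ i j := fun u hu => by simpa using hB hu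
        have hi : i ∉ B := fun h => (hB i h).1 rfl
        have hj : j ∉ B := fun h => (hB j h).2.1 rfl
        refine ⟨insert i (insert j B), ⟨?_, i, by simp, j, by simp, hadj, hlt, ?_⟩,
          hins i j B hadj.ne hi hj⟩
        · rw [Finset.card_insert_of_notMem (by simp [hadj.ne, hi]),
            Finset.card_insert_of_notMem hj]
          omega
        · intro u hu
          rw [Finset.mem_insert, Finset.mem_insert] at hu
          exact hu.imp_right fun h => h.imp_right (hB u)
      · rintro ⟨W, ⟨hcard, i, hi, j, hj, hadj, hlt, hW⟩, rfl⟩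
        refine ⟨i, j, ⟨hadj, hlt⟩, (W.erase i).erase j, fun u hu => ?_, ?_, ?_⟩
        · simp only [Finset.mem_erase] at hu
          simpa [hu.1, hu.2.1] using hW u hu.2.2
        · rw [Finset.card_erase_of_mem (Finset.mem_erase.2 ⟨hadj.ne', hj⟩),
            Finset.card_erase_of_mem hi]
          omega
        · rw [← hins i j _ hadj.ne (by simp) (by simp),
            Finset.insert_erase (Finset.mem_erase.2 ⟨hadj.ne', hj⟩), Finset.insert_erase hi]
  · rintro ⟨i, j⟩ he m hm
    simp only [Finset.mem_filter, Finset.mem_univ, true_and] at he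
    obtain ⟨hadj, hlt⟩ := he
    have hm' := (single_add_single_le hadj.ne).1 hm
    simp only [Finset.mem_filter, Finset.mem_univ, true_and, Prod.exists, Prod.Lex.toLex_lt_toLex]
    have hval : ∀ u, u ≠ i → u ≠ j →
        (Finsupp.single i 1 + Finsupp.single j 1 : V →₀ ℕ) u = 0 := fun u hi hj => by
      simp [hi, hj]
    constructor
    · rintro ⟨a, b, ⟨hab, hablt⟩, hord, hle⟩
      have hle' := (single_add_single_le hab.ne).1 hle
      rcases hG i j a b hadj hlt hab hablt hord with h | h
      · exact ⟨a, h, by rw [hval a h.1 h.2.1]; omega⟩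
      · exact ⟨b, h, by rw [hval b h.1 h.2.1]; omega⟩
    · rintro ⟨u, ⟨hui, huj, hu⟩, hlt'⟩
      rw [hval u hui huj] at hlt'
      rcases hu with ⟨h1, h2⟩ | ⟨h1, h2⟩
      · exact ⟨u, j, ⟨h1, by omega⟩, Or.inr ⟨rfl, h2⟩,
          (single_add_single_le h1.ne).2 ⟨by omega, hm'.2⟩⟩
      · rcases lt_or_gt_of_ne (hρ.ne hui) with hlt2 | hlt2
        · exact ⟨u, i, ⟨h1, hlt2⟩, Or.inl hlt, (single_add_single_le h1.ne).2 ⟨by omega, hm'.1⟩⟩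
        · exact ⟨i, u, ⟨h1.symm, hlt2⟩, Or.inl h2,
            (single_add_single_le h1.ne').2 ⟨hm'.1, by omega⟩⟩

theorem HS_edgeIdeal {𝕜 : Type*} [Field 𝕜] [Finite V] {G : SimpleGraph V} {ρ : V → ℕ}
    (hρ : Function.Injective ρ) (hG : LexLinear G ρ) (k : ℕ) :
    HS k (edgeIdeal 𝕜 G) = setIdeal 𝕜 (shiftSets G ρ k) := by
  classical
  obtain ⟨D, hD, hDk⟩ := hasRes_edgeExponents (𝕜 := 𝕜) hρ hG
  rw [HS_eq_span hD ?_ (fun _ => mem_edgeIdeal) ?_, hDk, setIdeal]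
  · rintro a b hab ⟨u, v, h, h'⟩
    exact ⟨u, v, h, h'.trans hab⟩
  · rw [Ideal.ne_top_iff_one, mem_edgeIdeal]
    intro h
    obtain ⟨u, v, huv, hle⟩ := h 0 (by simp)
    have := (single_add_single_le huv.ne).1 hle
    simp at this

end EdgeIdeal

end

/-! ### The complement of `LH` -/

noncomputable section

open MvPolynomial

theorem setIdeal_ne_bot {V 𝕜 : Type*} [Field 𝕜] {𝒲 : Set (Finset V)} (h : 𝒲.Nonempty) :
    setIdeal 𝕜 𝒲 ≠ ⊥ := by
  obtain ⟨W, hW⟩ := h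
  intro hbot
  have : monomial (ind W) (1 : 𝕜) ∈ setIdeal 𝕜 𝒲 := Ideal.subset_span ⟨_, ⟨W, hW, rfl⟩, rfl⟩
  rw [hbot, Ideal.mem_bot, monomial_eq_zero] at this
  exact one_ne_zero this

/-- The edges `i j` with `i < j` of the following graph: the complement of a path `1, …, m`, with
one leaf `m + 1` attached to `1` and the leaves `m + 2, m + 3, …` attached to `m`. -/
def rankEdge (m i j : ℕ) : Prop :=
  (j ≤ m ∧ i + 2 ≤ j) ∨ (i = 1 ∧ j = m + 1) ∨ (i = m ∧ m + 2 ≤ j)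

/-- The bijection `ρ` from the vertices to `{1, …, N}` identifies `G` with the graph described by
`rankEdge m`. -/
structure IsRanked {V : Type*} (G : SimpleGraph V) (ρ : V → ℕ) (m N : ℕ) : Prop where
  inj : Function.Injective ρ
  pos : ∀ v, 1 ≤ ρ v
  le : ∀ v, ρ v ≤ N
  surj : ∀ t, 1 ≤ t → t ≤ N → ∃ v, ρ v = t
  adj : ∀ u v, ρ u < ρ v → (G.Adj u v ↔ rankEdge m (ρ u) (ρ v))

namespace IsRanked

variable {V : Type*} {G : SimpleGraph V} {ρ : V → ℕ} {m N : ℕ}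

theorem adj_iff (h : IsRanked G ρ m N) (u v : V) : G.Adj u v ↔
    (ρ u < ρ v ∧ rankEdge m (ρ u) (ρ v)) ∨ (ρ v < ρ u ∧ rankEdge m (ρ v) (ρ u)) := by
  rcases lt_trichotomy (ρ u) (ρ v) with hlt | heq | hlt
  · rw [h.adj u v hlt]; simp [hlt, hlt.not_gt]
  · rw [h.inj heq]; simp
  · rw [G.adj_comm, h.adj v u hlt]; simp [hlt, hlt.not_gt]

theorem mem_colonVars (h : IsRanked G ρ m N) (i j u : V) : u ∈ colonVars G ρ i j ↔
    ρ u ≠ ρ i ∧ ρ u ≠ ρ j ∧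
      (((ρ u < ρ j ∧ rankEdge m (ρ u) (ρ j)) ∨ (ρ j < ρ u ∧ rankEdge m (ρ j) (ρ u))) ∧
        ρ u < ρ i ∨
      ((ρ u < ρ i ∧ rankEdge m (ρ u) (ρ i)) ∨ (ρ i < ρ u ∧ rankEdge m (ρ i) (ρ u))) ∧
        ρ u < ρ j) := by
  simp only [colonVars, Set.mem_ofPred_eq, h.adj_iff, h.inj.ne_iff]

theorem mem_colonVars_of_lt (h : IsRanked G ρ m N) {i j u : V} (hij : ρ i < ρ j)
    (hui : ρ u < ρ i) (hu : rankEdge m (ρ u) (ρ i) ∨ rankEdge m (ρ u) (ρ j)) :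
    u ∈ colonVars G ρ i j := by
  have huj := hui.trans hij
  refine ⟨fun e => hui.ne (by rw [e]), fun e => huj.ne (by rw [e]), ?_⟩
  rw [h.adj u i hui, h.adj u j huj]
  exact hu.symm.imp (fun h' => ⟨h', hui⟩) fun h' => ⟨h', huj⟩

theorem mem_colonVars_of_gt (h : IsRanked G ρ m N) {i j u : V} (hiu : ρ i < ρ u)
    (huj : ρ u < ρ j) (hu : rankEdge m (ρ i) (ρ u)) : u ∈ colonVars G ρ i j := by
  refine ⟨fun e => hiu.ne (by rw [e]), fun e => huj.ne (by rw [e]), Or.inr ⟨?_, huj⟩⟩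
  rw [G.adj_comm, h.adj i u hiu]
  exact hu

theorem lexLinear (h : IsRanked G ρ m N) (hm : 4 ≤ m) : LexLinear G ρ := by
  intro i j a b hij hlt hab hablt hord
  rw [h.adj i j hlt] at hij
  rw [h.adj a b hablt] at hab
  have hi := h.pos i
  have ha := h.pos a
  rcases hij with hij | hij | hij
  · by_cases hai : ρ a < ρ i
    · exact Or.inl (h.mem_colonVars_of_lt hlt hai (Or.inr (Or.inl (by omega))))
    · unfold rankEdge at hab
      exact Or.inr (h.mem_colonVars_of_gt (by omega) (by omega) (Or.inl (by omega)))
  · unfold rankEdge at hab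
    exact Or.inr (h.mem_colonVars_of_gt (by omega) (by omega) (Or.inl (by omega)))
  · rcases hab with hab | hab | hab
    · exact Or.inl (h.mem_colonVars_of_lt hlt (by omega) (Or.inl (Or.inl (by omega))))
    · exact Or.inl (h.mem_colonVars_of_lt hlt (by omega) (Or.inl (Or.inl (by omega))))
    · exact Or.inr (h.mem_colonVars_of_gt (by omega) (by omega) (Or.inr (Or.inr (by omega))))

/-- The supports of the generators have three shapes: proper subsets of the path, sets containing
the leaf `m + 1` at its first vertex, and sets containing leaves at its last vertex. -/
theorem cases_of_mem_shiftSets (h : IsRanked G ρ m N) (hm : 4 ≤ m) {k : ℕ}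
    {W : Finset V} (hW : W ∈ shiftSets G ρ k) :
    ((∀ u ∈ W, ρ u ≤ m) ∧ ∃ x ≤ m, 1 ≤ x ∧ ∀ u ∈ W, ρ u ≠ x) ∨
    (∀ u ∈ W, ρ u = 1 ∨ 3 ≤ ρ u ∧ ρ u ≤ m + 1) ∨
    ((∃ u ∈ W, ρ u = m) ∧ ∀ u ∈ W, ρ u = m ∨ ρ u + 2 ≤ m ∨ m + 2 ≤ ρ u) := by
  obtain ⟨-, i, hi, j, hj, hadj, hlt, hu⟩ := hW
  rw [h.adj i j hlt] at hadj
  have hu' : ∀ u ∈ W, ρ u = ρ i ∨ ρ u = ρ j ∨ u ∈ colonVars G ρ i j := fun u huW => by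
    rcases hu u huW with rfl | rfl | h'
    · exact Or.inl rfl
    · exact Or.inr (Or.inl rfl)
    · exact Or.inr (Or.inr h')
  simp only [h.mem_colonVars] at hu'
  have hpos := h.pos i
  unfold rankEdge at hadj hu'
  rcases hadj with hadj | hadj | hadj
  · refine Or.inl ⟨fun u huW => ?_, ρ i + 1, by omega, by omega, fun u huW => ?_⟩ <;>
      have := hu' u huW <;> omega
  · refine Or.inr (Or.inl fun u huW => ?_)
    have := hu' u huW
    have := h.pos u
    omega
  · refine Or.inr (Or.inr ⟨⟨i, hi, hadj.1⟩, fun u huW => ?_⟩)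
    have := hu' u huW
    omega

theorem mem_shiftSets_of_first (h : IsRanked G ρ m N) (hm : 4 ≤ m) {k : ℕ} {W : Finset V}
    (hcard : W.card = k + 2) (h1 : ∃ u ∈ W, ρ u = 1) (h2 : ∃ u ∈ W, ρ u = m + 1)
    (hW : ∀ u ∈ W, ρ u = 1 ∨ 3 ≤ ρ u ∧ ρ u ≤ m + 1) : W ∈ shiftSets G ρ k := by
  obtain ⟨i, hi, hi1⟩ := h1
  obtain ⟨j, hj, hjm⟩ := h2
  have hlt : ρ i < ρ j := by omega
  refine ⟨hcard, i, hi, j, hj, ?_, hlt, fun u hu => ?_⟩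
  · rw [h.adj i j hlt]
    exact Or.inr (Or.inl ⟨hi1, hjm⟩)
  · rw [h.mem_colonVars, ← h.inj.eq_iff (a := u), ← h.inj.eq_iff (a := u)]
    have := hW u hu
    unfold rankEdge
    omega

theorem mem_shiftSets_of_last (h : IsRanked G ρ m N) (hm : 4 ≤ m) {k : ℕ} {W : Finset V}
    (hcard : W.card = k + 2) (h1 : ∃ u ∈ W, ρ u = m) (h2 : ∃ u ∈ W, m + 2 ≤ ρ u)
    (hW : ∀ u ∈ W, ρ u = m ∨ ρ u + 2 ≤ m ∨ m + 2 ≤ ρ u) : W ∈ shiftSets G ρ k := by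
  obtain ⟨i, hi, him⟩ := h1
  obtain ⟨y, hy, hym⟩ := h2
  obtain ⟨j, hj, hmax⟩ := W.exists_max_image ρ ⟨y, hy⟩
  have hjy := hmax y hy
  have hlt : ρ i < ρ j := by omega
  refine ⟨hcard, i, hi, j, hj, ?_, hlt, fun u hu => ?_⟩
  · rw [h.adj i j hlt]
    exact Or.inr (Or.inr ⟨him, by omega⟩)
  · rw [h.mem_colonVars, ← h.inj.eq_iff (a := u), ← h.inj.eq_iff (a := u)]
    have := hW u hu
    have := hmax u hu
    have := h.pos u
    unfold rankEdge
    omega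

theorem card_le (h : IsRanked G ρ m N) {W : Finset V} {T : Finset ℕ} (hW : ∀ u ∈ W, ρ u ∈ T) :
    W.card ≤ T.card :=
  Finset.card_le_card_of_injOn ρ hW h.inj.injOn

theorem exists_card_eq (h : IsRanked G ρ m N) {T : Finset ℕ} (hT : ∀ t ∈ T, 1 ≤ t ∧ t ≤ N) :
    ∃ W : Finset V, W.card = T.card ∧ ∀ v, v ∈ W ↔ ρ v ∈ T := by
  classical
  have hex : ∀ t : T, ∃ v, ρ v = t := fun t => h.surj t (hT t t.2).1 (hT t t.2).2
  choose g hg using hex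
  have hginj : Function.Injective g := fun s t hst => Subtype.ext (by rw [← hg, ← hg, hst])
  refine ⟨Finset.univ.image g, ?_, fun v => ?_⟩
  · rw [Finset.card_image_of_injective _ hginj, Finset.card_univ, Fintype.card_coe]
  · simp only [Finset.mem_image, Finset.mem_univ, true_and]
    constructor
    · rintro ⟨t, rfl⟩
      rw [hg]; exact t.2
    · intro hv
      exact ⟨⟨ρ v, hv⟩, h.inj (hg _)⟩

theorem shiftSets_eq_empty (h : IsRanked G ρ m N) (hm : 4 ≤ m) (hN : m + 3 ≤ N) {k : ℕ}
    (hk : N < k + 4) : shiftSets G ρ k = ∅ := by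
  rw [Set.eq_empty_iff_forall_notMem]
  intro W hW
  have hcard := hW.1
  rcases h.cases_of_mem_shiftSets hm hW with ⟨hP, -⟩ | hZ | ⟨-, hY⟩
  · have := h.card_le (T := Finset.Icc 1 m) fun u hu => Finset.mem_Icc.2 ⟨h.pos u, hP u hu⟩
    rw [Nat.card_Icc] at this
    omega
  · have := h.card_le (T := Finset.Icc 1 (m + 1)) fun u hu => by
      have := hZ u hu
      rw [Finset.mem_Icc]; omega
    rw [Nat.card_Icc] at this
    omega
  · have hT := h.card_le (T := Finset.Icc 1 N \ {m - 1, m + 1}) fun u hu => by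
      have := hY u hu
      have := h.pos u
      have := h.le u
      simp only [Finset.mem_sdiff, Finset.mem_Icc, Finset.mem_insert, Finset.mem_singleton]
      omega
    rw [Finset.card_sdiff_of_subset (fun t ht => by
      simp only [Finset.mem_insert, Finset.mem_singleton] at ht
      rw [Finset.mem_Icc]; omega), Finset.card_pair (by omega), Nat.card_Icc] at hT
    omega

/-- In high degree only the sets with leaves at the last vertex `m` of the path remain: they
consist of `m` and an arbitrary set of vertices other than `m - 1`, `m` and `m + 1`. -/
theorem mem_shiftSets_iff (h : IsRanked G ρ m N) (hm : 4 ≤ m) {k : ℕ}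
    (hk : m < k + 2) (W : Finset V) : W ∈ shiftSets G ρ k ↔ W.card = k + 2 ∧
      (∃ u ∈ W, ρ u = m) ∧ ∀ u ∈ W, ρ u = m ∨ ρ u + 2 ≤ m ∨ m + 2 ≤ ρ u := by
  constructor
  · intro hW
    have hcard := hW.1
    refine ⟨hcard, ?_⟩
    rcases h.cases_of_mem_shiftSets hm hW with ⟨hP, -⟩ | hZ | hY
    · have := h.card_le (T := Finset.Icc 1 m) fun u hu => Finset.mem_Icc.2 ⟨h.pos u, hP u hu⟩
      rw [Nat.card_Icc] at this
      omega
    · have hT := h.card_le (T := (Finset.Icc 1 (m + 1)).erase 2) fun u hu => by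
        have := hZ u hu
        rw [Finset.mem_erase, Finset.mem_Icc]; omega
      rw [Finset.card_erase_of_mem (by rw [Finset.mem_Icc]; omega), Nat.card_Icc] at hT
      omega
    · exact hY
  · rintro ⟨hcard, h1, hW⟩
    refine h.mem_shiftSets_of_last hm hcard h1 ?_ hW
    by_contra! hcon
    have := h.card_le (T := Finset.Icc 1 m) fun u hu => by
      have := hW u hu
      have := hcon u hu
      have := h.pos u
      rw [Finset.mem_Icc]; omega
    rw [Nat.card_Icc] at this
    omega

theorem shiftSets_nonempty_of_high (h : IsRanked G ρ m N) (hm : 4 ≤ m) (hN : m + 3 ≤ N) {k : ℕ}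
    (hk : m < k + 2) (hkN : k + 4 ≤ N) : (shiftSets G ρ k).Nonempty := by
  obtain ⟨T, hmT, hT, hcard⟩ := Finset.exists_subsuperset_card_eq (s := {m})
    (t := Finset.Icc 1 N \ {m - 1, m + 1}) (n := k + 2) (by
      rw [Finset.singleton_subset_iff]
      simp only [Finset.mem_sdiff, Finset.mem_Icc, Finset.mem_insert, Finset.mem_singleton]
      omega) (by rw [Finset.card_singleton]; omega) (by
      rw [Finset.card_sdiff_of_subset (fun t ht => by
        simp only [Finset.mem_insert, Finset.mem_singleton] at ht
        rw [Finset.mem_Icc]; omega), Finset.card_pair (by omega), Nat.card_Icc]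
      omega)
  have hT' : ∀ t ∈ T, (1 ≤ t ∧ t ≤ N) ∧ t ≠ m - 1 ∧ t ≠ m + 1 := fun t ht => by
    simpa using hT ht
  obtain ⟨W, hWcard, hW⟩ := h.exists_card_eq fun t ht => (hT' t ht).1
  refine ⟨W, (h.mem_shiftSets_iff hm hk W).2 ⟨hWcard.trans hcard, ?_, fun u hu => ?_⟩⟩
  · obtain ⟨u, hu⟩ := h.surj m (by omega) (by omega)
    exact ⟨u, (hW u).2 (hu ▸ Finset.singleton_subset_iff.1 hmT), hu⟩
  · have := hT' _ ((hW u).1 hu)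
    omega

/-- Up to the common factor `m`, the generators in high degree are all squarefree monomials of a
given degree in some variables, so the colexicographic order gives linear quotients. -/
theorem hasLinearQuotients_of_high [Finite V] {𝕜 : Type*} [Field 𝕜] (h : IsRanked G ρ m N)
    (hm : 4 ≤ m) {k : ℕ} (hk : m < k + 2) :
    HasLinearQuotients (setIdeal 𝕜 (shiftSets G ρ k)) := by
  classical
  refine hasLinearQuotients_of_exchange (Set.toFinite _) (fun W hW => hW.1)
    (fun W => toColex (W.image ρ))
    (fun W W' hWW => Finset.image_injective h.inj (toColex.injective hWW)) ?_
  intro W hW W' hW' hlt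
  rw [Finset.Colex.toColex_lt_toColex_iff_exists_forall_lt] at hlt
  obtain ⟨a, haW, haW', ha⟩ := hlt
  obtain ⟨u, huW, rfl⟩ := Finset.mem_image.1 haW
  have huW' : u ∉ W' := fun hu => haW' (Finset.mem_image_of_mem ρ hu)
  obtain ⟨v, hv⟩ : (W' \ W).Nonempty := by
    rw [Finset.sdiff_nonempty]
    intro hsub
    exact huW' (Finset.eq_of_subset_of_card_le hsub (by rw [hW.1, hW'.1]) ▸ huW)
  obtain ⟨hvW', hvW⟩ := Finset.mem_sdiff.1 hv
  have hW₀ := (h.mem_shiftSets_iff hm hk W).1 hW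
  have hW₀' := (h.mem_shiftSets_iff hm hk W').1 hW'
  have hvE : v ∉ W.erase u := fun hvE => hvW (Finset.mem_of_mem_erase hvE)
  refine ⟨insert v (W.erase u), (h.mem_shiftSets_iff hm hk _).2 ⟨?_, ?_, fun w hw => ?_⟩, ?_,
    v, hv, Finset.insert_subset_insert _ (Finset.erase_subset _ _)⟩
  · rw [Finset.card_insert_of_notMem hvE, Finset.card_erase_add_one huW, hW.1]
  · obtain ⟨x, hx, hxm⟩ := hW₀.2.1
    obtain ⟨x', hx', hxm'⟩ := hW₀'.2.1
    have hxx : x = x' := h.inj (hxm.trans hxm'.symm)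
    have hxu : x ≠ u := fun e => huW' (e ▸ hxx ▸ hx')
    exact ⟨x, Finset.mem_insert_of_mem (Finset.mem_erase.2 ⟨hxu, hx⟩), hxm⟩
  · rcases Finset.mem_insert.1 hw with rfl | hw
    · exact hW₀'.2.2 w hvW'
    · exact hW₀.2.2 w (Finset.mem_of_mem_erase hw)
  · rw [Finset.Colex.toColex_lt_toColex_iff_exists_forall_lt]
    have hlt : ρ v < ρ u := ha _ (Finset.mem_image_of_mem ρ hvW') fun hmem => by
      obtain ⟨x, hx, hxv⟩ := Finset.mem_image.1 hmem
      exact hvW (h.inj hxv ▸ hx)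
    refine ⟨ρ u, haW, fun hmem => ?_, fun b hb hbW => ?_⟩
    · obtain ⟨x, hx, hxu⟩ := Finset.mem_image.1 hmem
      obtain rfl := h.inj hxu
      rcases Finset.mem_insert.1 hx with rfl | hx
      · exact lt_irrefl _ hlt
      · exact Finset.notMem_erase _ _ hx
    · obtain ⟨x, hx, rfl⟩ := Finset.mem_image.1 hb
      rcases Finset.mem_insert.1 hx with rfl | hx
      · exact hlt
      · exact (hbW (Finset.mem_image_of_mem ρ (Finset.mem_of_mem_erase hx))).elim

/-- In low degree, choose a set `T` of `k + 1` vertices of the path that contains `1`, `m - 1` and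
`m`, but not `2`. The only generators dividing the product of `T ∪ {m + 1, m + 2, m + 3}` are those
with support `T ∪ {m + 1}` and `(T \ {m - 1}) ∪ {m + 2, m + 3}`, and these two differ in more than
one variable. -/
theorem not_hasLinearQuotients_of_low [Finite V] {𝕜 : Type*} [Field 𝕜] (h : IsRanked G ρ m N)
    (hm : 4 ≤ m) (hN : m + 3 ≤ N) {k : ℕ} (hk2 : 2 ≤ k) (hk : k + 2 ≤ m) :
    (shiftSets G ρ k).Nonempty ∧ ¬ HasLinearQuotients (setIdeal 𝕜 (shiftSets G ρ k)) := by
  classical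
  obtain ⟨T, hsT, hTs, hcard⟩ := Finset.exists_subsuperset_card_eq (s := {1, m - 1, m})
    (t := (Finset.Icc 1 m).erase 2) (n := k + 1) (fun t ht => by
      simp only [Finset.mem_insert, Finset.mem_singleton] at ht
      rw [Finset.mem_erase, Finset.mem_Icc]; omega)
    (Finset.card_le_three.trans (by omega))
    (by
      rw [Finset.card_erase_of_mem (by rw [Finset.mem_Icc]; omega), Nat.card_Icc]
      omega)
  have hT : ∀ t ∈ T, t ≠ 2 ∧ 1 ≤ t ∧ t ≤ m := fun t ht => by simpa using hTs ht
  have h1T : 1 ∈ T := hsT (by simp)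
  have hm1T : m - 1 ∈ T := hsT (by simp)
  have hmT : m ∈ T := hsT (by simp)
  have hnot : ∀ t, m < t → t ∉ T := fun t ht htT => by have := hT t htT; omega
  have hT1 : ∀ t ∈ insert (m + 1) T, 1 ≤ t ∧ t ≤ N := fun t ht => by
    rcases Finset.mem_insert.1 ht with rfl | ht
    · omega
    · have := hT t ht; omega
  have hT2 : ∀ t ∈ insert (m + 2) (insert (m + 3) (T.erase (m - 1))), 1 ≤ t ∧ t ≤ N :=
    fun t ht => by
      simp only [Finset.mem_insert, Finset.mem_erase] at ht
      rcases ht with rfl | rfl | ht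
      · omega
      · omega
      · have := hT t ht.2; omega
  obtain ⟨W₁, hc₁, hW₁⟩ := h.exists_card_eq hT1
  obtain ⟨W₂, hc₂, hW₂⟩ := h.exists_card_eq hT2
  rw [Finset.card_insert_of_notMem (hnot _ (by omega)), hcard] at hc₁
  rw [Finset.card_insert_of_notMem (by simp [hnot]),
    Finset.card_insert_of_notMem (by simp [hnot]), Finset.card_erase_add_one hm1T, hcard] at hc₂
  simp only [Finset.mem_insert, Finset.mem_erase] at hW₁ hW₂
  obtain ⟨p₁, hp₁⟩ := h.surj 1 (by omega) (by omega)
  obtain ⟨pm, hpm⟩ := h.surj m (by omega) (by omega)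
  obtain ⟨p', hp'⟩ := h.surj (m - 1) (by omega) (by omega)
  obtain ⟨z, hz⟩ := h.surj (m + 1) (by omega) (by omega)
  obtain ⟨y, hy⟩ := h.surj (m + 2) (by omega) (by omega)
  have hmem₁ : W₁ ∈ shiftSets G ρ k := by
    refine h.mem_shiftSets_of_first hm hc₁ ⟨p₁, (hW₁ _).2 ?_, hp₁⟩ ⟨z, (hW₁ _).2 ?_, hz⟩
      fun u hu => ?_
    · rw [hp₁]; exact Or.inr h1T
    · exact Or.inl hz
    · rcases (hW₁ u).1 hu with h' | h'
      · omega
      · have := hT _ h'; omega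
  have hmem₂ : W₂ ∈ shiftSets G ρ k := by
    refine h.mem_shiftSets_of_last hm hc₂ ⟨pm, (hW₂ _).2 ?_, hpm⟩ ⟨y, (hW₂ _).2 ?_, hy.ge⟩
      fun u hu => ?_
    · rw [hpm]; exact Or.inr (Or.inr ⟨by omega, hmT⟩)
    · exact Or.inl hy
    · rcases (hW₂ u).1 hu with h' | h' | h'
      · omega
      · omega
      · have := hT _ h'.2; omega
  refine ⟨⟨W₁, hmem₁⟩, not_hasLinearQuotients_of_isolated (fun W hW => hW.1) hmem₁ hmem₂
    (fun W hW hsub => ?_) ?_⟩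
  · have hWT : ∀ u ∈ W, ρ u = m + 1 ∨ ρ u = m + 2 ∨ ρ u = m + 3 ∨ ρ u ∈ T := fun u hu => by
      rcases Finset.mem_union.1 (hsub hu) with hu | hu
      · rcases (hW₁ u).1 hu with h' | h' <;> simp [h']
      · rcases (hW₂ u).1 hu with h' | h' | h' <;> simp [h']
    rcases h.cases_of_mem_shiftSets hm hW with ⟨hP, -⟩ | hZ | ⟨-, hY⟩
    · have := h.card_le (T := T) fun u hu => by
        have := hP u hu
        rcases hWT u hu with h' | h' | h' | h'
        · omega
        · omega
        · omega
        · exact h'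
      rw [hcard, hW.1] at this
      omega
    · left
      refine Finset.eq_of_subset_of_card_le (fun u hu => (hW₁ u).2 ?_) (by rw [hc₁, hW.1])
      have := hZ u hu
      rcases hWT u hu with h' | h' | h' | h'
      · exact Or.inl h'
      · omega
      · omega
      · exact Or.inr h'
    · right
      refine Finset.eq_of_subset_of_card_le (fun u hu => (hW₂ u).2 ?_) (by rw [hc₂, hW.1])
      have := hY u hu
      rcases hWT u hu with h' | h' | h' | h'
      · omega
      · exact Or.inl h'
      · exact Or.inr (Or.inl h')
      · exact Or.inr (Or.inr ⟨by omega, h'⟩)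
  · rw [Finset.one_lt_card]
    refine ⟨z, ?_, p', ?_, fun e => ?_⟩
    · rw [Finset.mem_sdiff, hW₁, hW₂, hz]
      exact ⟨Or.inl rfl, by simp [hnot]⟩
    · rw [Finset.mem_sdiff, hW₁, hW₂, hp']
      exact ⟨Or.inr hm1T, by omega⟩
    · rw [e] at hz; omega

end IsRanked

/-- The position of the vertex `x_{v + 1}` in the list `x_1, …, x_{n-4}, x_{n-2}, x_{n-3}` of the
vertices of the path in `LH`, continued by `x_{n-1}, x_n, …, x_{n+r}`. -/
def rankLH (n r : ℕ) (v : Fin (n + r)) : ℕ :=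
  if v.val + 1 = n - 3 then n - 2 else if v.val + 1 = n - 2 then n - 3 else v.val + 1

theorem one_le_rankLH {n r : ℕ} (hn : 6 ≤ n) (v : Fin (n + r)) : 1 ≤ rankLH n r v := by
  unfold rankLH; split_ifs <;> omega

theorem rankLH_le {n r : ℕ} (hn : 6 ≤ n) (v : Fin (n + r)) : rankLH n r v ≤ n + r := by
  have := v.isLt
  unfold rankLH; split_ifs <;> omega

/-- `a` is the label of the vertex whose position in the list of `rankLH` is `i`. -/
def IsLabel (n i a : ℕ) : Prop :=
  (i ≤ n - 4 ∧ a = i) ∨ (i = n - 3 ∧ a = n - 2) ∨ (i = n - 2 ∧ a = n - 3) ∨ (n - 1 ≤ i ∧ a = i)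

theorem isLabel_rankLH {n r : ℕ} (hn : 6 ≤ n) (v : Fin (n + r)) :
    IsLabel n (rankLH n r v) (v.val + 1) := by
  unfold IsLabel rankLH
  split_ifs <;> omega

theorem edgeLH_of_not_rankEdge {n r i j a b : ℕ} (hn : 6 ≤ n) (hi : 1 ≤ i) (hij : i < j)
    (hj : j ≤ n + r) (ha : IsLabel n i a) (hb : IsLabel n j b) (h : ¬ rankEdge (n - 2) i j) :
    edgeLH n r a b ∨ edgeLH n r b a := by
  obtain ⟨p, rfl⟩ : ∃ p, n = p + 6 := ⟨n - 6, by omega⟩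
  simp only [rankEdge, not_or, not_and, IsLabel, Nat.reduceSubDiff] at h ha hb
  obtain ⟨h1, h2, h3⟩ := h
  have hlast : p + 6 ≤ j → i ≠ p + 4 := fun hj' hi' => h3 hi' hj'
  have hfirst : j = p + 5 → i ≠ 1 := fun hj' hi' => h2 hi' hj'
  clear h2 h3
  simp only [edgeLH, edgeH, Finset.mem_Icc, Finset.mem_sdiff, Finset.mem_insert,
    Finset.mem_singleton, Nat.reduceSubDiff]
  -- In the first three cases both ends are consecutive vertices of the path.
  rcases hb with ⟨hj', rfl⟩ | ⟨rfl, rfl⟩ | ⟨rfl, rfl⟩ | ⟨hj', rfl⟩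
  · have := h1 (by omega)
    clear h1 hlast hfirst
    refine Or.inl (Or.inl (Or.inl ?_))
    omega
  · have := h1 (by omega)
    clear h1 hlast hfirst
    refine Or.inl (Or.inl (Or.inr (Or.inl ?_)))
    omega
  · have := h1 (by omega)
    clear h1 hlast hfirst
    refine Or.inl (Or.inl (Or.inr (Or.inr (Or.inl ?_))))
    omega
  · clear h1
    rcases lt_trichotomy b (p + 6) with hbn | hbn | hbn
    · have := hfirst (by omega)
      clear hfirst hlast
      refine Or.inr (Or.inl (Or.inr (Or.inr (Or.inr (Or.inl ⟨by omega, ?_⟩)))))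
      omega
    · have := hlast (by omega)
      clear hfirst hlast
      refine Or.inr (Or.inl (Or.inr (Or.inr (Or.inr (Or.inr ⟨by omega, ?_⟩)))))
      omega
    · have := hlast (by omega)
      clear hfirst hlast
      by_cases han : a ≤ p + 6
      · refine Or.inr (Or.inr (Or.inl ⟨by omega, ?_⟩))
        omega
      · refine Or.inr (Or.inr (Or.inr ⟨by omega, ?_⟩))
        omega

theorem not_rankEdge_of_edgeLH {n r i j a b : ℕ} (hn : 6 ≤ n)
    (ha : IsLabel n i a) (hb : IsLabel n j b) (h : edgeLH n r a b ∨ edgeLH n r b a) :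
    ¬ rankEdge (n - 2) i j := by
  simp only [edgeLH, edgeH, Finset.mem_Icc, Finset.mem_sdiff, Finset.mem_insert,
    Finset.mem_singleton] at h
  unfold IsLabel at ha hb
  rintro (hR | hR | hR) <;>
    rcases h with ((h | h | h | h | h) | h | h) | ((h | h | h | h | h) | h | h) <;> omega

theorem isRanked_LH {n r : ℕ} (hn : 6 ≤ n) :
    IsRanked (LH n r)ᶜ (rankLH n r) (n - 2) (n + r) where
  inj u v huv := by
    unfold rankLH at huv
    ext
    split_ifs at huv <;> omega
  pos := one_le_rankLH hn
  le := rankLH_le hn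
  surj t ht1 ht := by
    by_cases h1 : t = n - 2
    · exact ⟨⟨n - 4, by omega⟩, by unfold rankLH; dsimp only; split_ifs <;> omega⟩
    by_cases h2 : t = n - 3
    · exact ⟨⟨n - 3, by omega⟩, by unfold rankLH; dsimp only; split_ifs <;> omega⟩
    · exact ⟨⟨t - 1, by omega⟩, by unfold rankLH; dsimp only; split_ifs <;> omega⟩
  adj u v huv := by
    have hne : u ≠ v := fun e => by rw [e] at huv; exact lt_irrefl _ huv
    have hadj : (LH n r)ᶜ.Adj u v ↔
        ¬ (edgeLH n r (u.val + 1) (v.val + 1) ∨ edgeLH n r (v.val + 1) (u.val + 1)) := by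
      simp [LH, hne]
    have hu := isLabel_rankLH hn u
    have hv := isLabel_rankLH hn v
    have hu1 := one_le_rankLH hn u
    rw [hadj, not_iff_comm]
    exact ⟨edgeLH_of_not_rankEdge hn hu1 huv (rankLH_le hn v) hu hv,
      not_rankEdge_of_edgeLH hn hu hv⟩

end

end HLQ

theorem theorem3p1 {𝕜 : Type*} [Field 𝕜] (n r : ℕ) (hn : 6 ≤ n) (hr : 1 ≤ r) :
    (∀ k : ℕ, 2 ≤ k → k ≤ n - 4 →
      HLQ.HS k (HLQ.edgeIdeal 𝕜 (HLQ.LH n r)ᶜ) ≠ ⊥ ∧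
      ¬ HLQ.HasLinearQuotients (HLQ.HS k (HLQ.edgeIdeal 𝕜 (HLQ.LH n r)ᶜ))) ∧
    (∀ k : ℕ, n - 4 < k → k ≤ n + r - 4 →
      HLQ.HS k (HLQ.edgeIdeal 𝕜 (HLQ.LH n r)ᶜ) ≠ ⊥ ∧
      HLQ.HasLinearQuotients (HLQ.HS k (HLQ.edgeIdeal 𝕜 (HLQ.LH n r)ᶜ))) ∧
    (∀ k : ℕ, n + r - 4 < k →
      HLQ.HS k (HLQ.edgeIdeal 𝕜 (HLQ.LH n r)ᶜ) = ⊥) := by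
  have h := HLQ.isRanked_LH (r := r) hn
  have hm : 4 ≤ n - 2 := by omega
  have hN : n - 2 + 3 ≤ n + r := by omega
  simp only [HLQ.HS_edgeIdeal h.inj (h.lexLinear hm)]
  refine ⟨fun k hk2 hk => ?_, fun k hk hkN => ?_, fun k hk => ?_⟩
  · obtain ⟨h1, h2⟩ := h.not_hasLinearQuotients_of_low (𝕜 := 𝕜) hm hN hk2 (by omega)
    exact ⟨HLQ.setIdeal_ne_bot h1, h2⟩
  · exact ⟨HLQ.setIdeal_ne_bot (h.shiftSets_nonempty_of_high hm hN (by omega) (by omega)),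
      h.hasLinearQuotients_of_high hm (by omega)⟩
  · rw [h.shiftSets_eq_empty hm hN (by omega), HLQ.setIdeal, Set.image_empty, Set.image_empty,
      Ideal.span_empty]
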